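/- Let $\mathcal D$ be a dyadic grid on $\mathbb R$ and let $\mu$ be a Borel measure on $\mathbb R$ without atoms, with $0<\mu(Q)<\infty$ for every $Q\in\mathcal D$ and infinite on each quadrant of $\mathcal D$ (the union of all dyadic ancestors of an interval). For $Q\in\mathcal D$ with right and left halves $Q_+,Q_-$ put $$m(Q)=\frac{\mu(Q_+)\mu(Q_-)}{\mu(Q)},\qquad h_Q=\sqrt{m(Q)}\Big(\frac{\mathbf 1_{Q_+}}{\mu(Q_+)}-\frac{\mathbf 1_{Q_-}}{\mu(Q_-)}\Big),$$ and assume that $\mu$ is balanced: $m(Q)\sim m(\widehat Q)$ uniformly in $Q\in\mathcal D$, where $\widehat Q$ is the dyadic parent of $Q$. Let $\mathcal D_s(Q)$ be the set of dyadic subintervals of $Q$ of length $2^{-s}|Q|$, and let $\mathrm{dist}(Q,R)$ be the least $a+b$ such that $Q\in\mathcal D_a(L)$ and $R\in\mathcal D_b(L)$ for some $L\in\mathcal D$ ($\infty$ if there is no such $L$). For $d,s,t\in\mathbb N=\{0,1,2,\dots\}$, a Haar shift of complexity $(s,t)$ is an operator on $L^2(\mu;\mathbb R^d)$ of the form $$Tf(x)=\sum_{Q\in\mathcal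 D}\int_Q K_Q(x,y)f(y)\,d\mu(y),\qquad K_Q(x,y)=\sum_{J\in\mathcal D_s(Q),\,K\in\mathcal D_t(Q)}c^Q_{J,K}\,h_J(y)h_K(x),$$ with real coefficients satisfying $|c^Q_{J,K}|\le 1$, the sum over $Q$ converging unconditionally in $L^2$. Let $1<p<\infty$, $p'=p/(p-1)$, $N\in\mathbb N$, and let $W$ be a $d\times d$ matrix weight, that is, a locally $\mu$-integrable function with values in the real symmetric $d\times d$ matrices which is positive definite $\mu$-almost everywhere. Let $\|f\|_{L^p(W)}=\big(\int|W^{1/p}f|^p\,d\mu\big)^{1/p}$. Suppose that there is a constant $C<\infty$ such that, for all $s,t\in\mathbb N$ with $s+t\le N$ and all Haar shifts $T$ of complexity $(s,t)$, $$\|Tf\|_{L^p(W)}\le C\|f\|_{L^p(W)}\qquad\text{for all } f\in L^2(\mu;\mathbb R^d)\cap L^p(W).$$ Then $W\in A_p^N$, that is, $$\sup_{\substack{Q,R\in\mathcal D\\ \mathrm{dist}(Q,R)\le N+2}} c_p^b(Q,R)\;\frac1{\mu(Q)}\int_Q\Big(\frac1{\mu(R)}\int_R\big|W(x)^{1/p}W(y)^{-1/p}\big|^{p'}d\mu(y)\Big)^{p/p'}d\mu(x)<\infty,$$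 where $|\cdot|$ is the operator norm, $c_p^b(Q,Q)=1$, and $c_p^b(Q,R)=\dfrac{m(Q)^{p/2}m(R)^{p/2}}{\mu(R)\mu(Q)^{p-1}}$ for $Q\ne R$. -/

import Mathlib

open MeasureTheory Set Filter Topology
open scoped ENNReal NNReal

namespace HaarShift

noncomputable section

/-- A dyadic grid on the real line. The intervals of generation `j` are the half-open intervals
`[offset j + k 2^j, offset j + (k + 1) 2^j)`, `k ∈ ℤ`; `offset_succ` says that each generation
refines the next coarser one. The standard grid is `offset = 0`, `shift = 0`. -/
structure DyadicGrid where
  offset : ℤ → ℝ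
  shift : ℤ → ℤ
  offset_succ : ∀ j : ℤ, offset (j + 1) = offset j + (shift j : ℝ) * (2 : ℝ) ^ j

/-- The dyadic interval `Q = (j, k)` is the one of length `2^j` at position `k`. Different labels
give different intervals, so that intervals of the grid are identified with their labels. -/
abbrev Idx : Type := ℤ × ℤ

/-- The set of points of the dyadic interval `Q`. -/
def DyadicGrid.interval (D : DyadicGrid) (Q : Idx) : Set ℝ :=
  Ico (D.offset Q.1 + (Q.2 : ℝ) * (2 : ℝ) ^ Q.1)
    (D.offset Q.1 + ((Q.2 : ℝ) + 1) * (2 : ℝ) ^ Q.1)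

/-- The left half `Q₋` of `Q`. -/
def DyadicGrid.leftChild (D : DyadicGrid) (Q : Idx) : Idx :=
  (Q.1 - 1, 2 * Q.2 + D.shift (Q.1 - 1))

/-- The right half `Q₊` of `Q`. -/
def DyadicGrid.rightChild (D : DyadicGrid) (Q : Idx) : Idx :=
  (Q.1 - 1, 2 * Q.2 + D.shift (Q.1 - 1) + 1)

theorem DyadicGrid.interval_leftChild (D : DyadicGrid) (Q : Idx) :
    D.interval (D.leftChild Q) =
      Ico (D.offset Q.1 + (Q.2 : ℝ) * (2 : ℝ) ^ Q.1)
        (D.offset Q.1 + ((Q.2 : ℝ) + 1 / 2) * (2 : ℝ) ^ Q.1) := by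
  have h := D.offset_succ (Q.1 - 1)
  have h2 : (2 : ℝ) ^ Q.1 = 2 * (2 : ℝ) ^ (Q.1 - 1) := by
    rw [zpow_sub_one₀ (two_ne_zero)]; ring
  rw [sub_add_cancel] at h
  simp only [DyadicGrid.interval, DyadicGrid.leftChild]
  push_cast
  rw [h, h2]
  congr 1 <;> ring

theorem DyadicGrid.interval_rightChild (D : DyadicGrid) (Q : Idx) :
    D.interval (D.rightChild Q) =
      Ico (D.offset Q.1 + ((Q.2 : ℝ) + 1 / 2) * (2 : ℝ) ^ Q.1)
        (D.offset Q.1 + ((Q.2 : ℝ) + 1) * (2 : ℝ) ^ Q.1) := by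
  have h := D.offset_succ (Q.1 - 1)
  have h2 : (2 : ℝ) ^ Q.1 = 2 * (2 : ℝ) ^ (Q.1 - 1) := by
    rw [zpow_sub_one₀ (two_ne_zero)]; ring
  rw [sub_add_cancel] at h
  simp only [DyadicGrid.interval, DyadicGrid.rightChild]
  push_cast
  rw [h, h2]
  congr 1 <;> ring

/-- `𝒟_s(Q)`: the `2^s` dyadic subintervals of `Q` of length `2^{-s} ℓ(Q)`. -/
def DyadicGrid.desc (D : DyadicGrid) : ℕ → Idx → Finset Idx
  | 0, Q => {Q}
  | s + 1, Q => D.desc s (D.leftChild Q) ∪ D.desc s (D.rightChild Q)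

/-- The distance of `Q` and `R` in the dyadic tree: the least `a + b` such that `Q` is `a`
generations and `R` is `b` generations below a common dyadic ancestor `L`. It is `⊤` if there is no
common ancestor. -/
def DyadicGrid.dist (D : DyadicGrid) (Q R : Idx) : ℕ∞ :=
  ⨅ (L : Idx) (a : ℕ) (b : ℕ) (_ : Q ∈ D.desc a L) (_ : R ∈ D.desc b L), ((a + b : ℕ) : ℕ∞)

/-- The quadrant of the grid that contains `Q`: the union of all dyadic ancestors of `Q`. -/
def DyadicGrid.quadrant (D : DyadicGrid) (Q : Idx) : Set ℝ :=
  ⋃ (L : Idx) (a : ℕ) (_ : Q ∈ D.desc a L), D.interval L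

/-- `m(Q) = μ(Q₊) μ(Q₋) / μ(Q)`. -/
def mQ (D : DyadicGrid) (μ : Measure ℝ) (Q : Idx) : ℝ :=
  μ.real (D.interval (D.rightChild Q)) * μ.real (D.interval (D.leftChild Q)) /
    μ.real (D.interval Q)

/-- The standing assumptions on the measure: it is positive and finite on dyadic intervals,
infinite on quadrants, without atoms, and balanced, i.e. `m(Q)` and `m(J)` are comparable,
uniformly, when `J` is a dyadic child of `Q`. -/
structure IsBalanced (D : DyadicGrid) (μ : Measure ℝ) : Prop where
  pos : ∀ Q, 0 < μ (D.interval Q)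
  lt_top : ∀ Q, μ (D.interval Q) < ∞
  quadrant : ∀ Q, μ (D.quadrant Q) = ∞
  noAtoms : ∀ x : ℝ, μ {x} = 0
  balanced : ∃ B : ℝ, ∀ Q, ∀ J ∈ D.desc 1 Q,
    mQ D μ J ≤ B * mQ D μ Q ∧ mQ D μ Q ≤ B * mQ D μ J

/-- The Haar function `h_Q = √m(Q) (1_{Q₊} / μ(Q₊) - 1_{Q₋} / μ(Q₋))`, normalized in `L²(μ)`. -/
def haar (D : DyadicGrid) (μ : Measure ℝ) (Q : Idx) (x : ℝ) : ℝ :=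
  √(mQ D μ Q) *
    ((D.interval (D.rightChild Q)).indicator
        (fun _ => 1 / μ.real (D.interval (D.rightChild Q))) x -
      (D.interval (D.leftChild Q)).indicator
        (fun _ => 1 / μ.real (D.interval (D.leftChild Q))) x)

/-- The kernel `K_Q(x, y) = ∑_{J ∈ 𝒟_s(Q), K ∈ 𝒟_t(Q)} c^Q_{J,K} h_J(y) h_K(x)`. -/
def kernel (D : DyadicGrid) (μ : Measure ℝ) (s t : ℕ) (c : Idx → Idx → Idx → ℝ) (Q : Idx)
    (x y : ℝ) : ℝ :=
  ∑ J ∈ D.desc s Q, ∑ K ∈ D.desc t Q, c Q J K * haar D μ J y * haar D μ K x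

/-- `T_Q f(x) = ∫_Q K_Q(x, y) f(y) dμ(y)`. -/
def localShift {d : ℕ} (D : DyadicGrid) (μ : Measure ℝ) (s t : ℕ) (c : Idx → Idx → Idx → ℝ)
    (Q : Idx) (f : ℝ → EuclideanSpace ℝ (Fin d)) (x : ℝ) : EuclideanSpace ℝ (Fin d) :=
  ∫ y in D.interval Q, kernel D μ s t c Q x y • f y ∂μ

/-- `T` is a Haar shift of complexity `(s, t)` on `L²(μ; ℝ^d)`: for some coefficients with
`|c^Q_{J,K}| ≤ 1` and all `f` in `L²`, `T f = ∑_Q T_Q f` with unconditional convergence in `L²`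
(so that `T f` is determined almost everywhere). -/
def IsHaarShift {d : ℕ} (D : DyadicGrid) (μ : Measure ℝ) (s t : ℕ)
    (T : (ℝ → EuclideanSpace ℝ (Fin d)) → (ℝ → EuclideanSpace ℝ (Fin d))) : Prop :=
  ∃ c : Idx → Idx → Idx → ℝ,
    (∀ Q, ∀ J ∈ D.desc s Q, ∀ K ∈ D.desc t Q, |c Q J K| ≤ 1) ∧
    ∀ f : ℝ → EuclideanSpace ℝ (Fin d), MemLp f 2 μ →
      MemLp (T f) 2 μ ∧
      Tendsto (fun S : Finset Idx =>
          eLpNorm (fun x => T f x - ∑ Q ∈ S, localShift D μ s t c Q f x) 2 μ)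
        atTop (𝓝 0)

/-- The real power `A^r` of a (positive definite) symmetric matrix, by functional calculus. -/
def matPow {d : ℕ} (A : Matrix (Fin d) (Fin d) ℝ) (r : ℝ) : Matrix (Fin d) (Fin d) ℝ :=
  cfc (fun t : ℝ => t ^ r) A

/-- A `d × d` matrix weight: a locally integrable matrix function, positive definite almost
everywhere. -/
structure IsMatrixWeight {d : ℕ} (μ : Measure ℝ) (W : ℝ → Matrix (Fin d) (Fin d) ℝ) : Prop where
  locallyIntegrable : ∀ i j, LocallyIntegrable (fun x => W x i j) μ
  posDef : ∀ᵐ x ∂μ, (W x).PosDef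

/-- `‖f‖_{L^p(W)} = (∫ |W(x)^{1/p} f(x)|^p dμ(x))^{1/p}`. -/
def normLpW {d : ℕ} (μ : Measure ℝ) (p : ℝ) (W : ℝ → Matrix (Fin d) (Fin d) ℝ)
    (f : ℝ → EuclideanSpace ℝ (Fin d)) : ℝ≥0∞ :=
  (∫⁻ x, ‖Matrix.toEuclideanCLM (n := Fin d) (𝕜 := ℝ) (matPow (W x) (1 / p)) (f x)‖ₑ ^ p ∂μ) ^
    (1 / p)

/-- `‖T‖_{L^p(W) → L^p(W)} ≤ C` for an operator `T` that is a priori defined on `L²(μ; ℝ^d)`. -/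
def BoundedOnLpW {d : ℕ} (μ : Measure ℝ) (p : ℝ) (W : ℝ → Matrix (Fin d) (Fin d) ℝ)
    (T : (ℝ → EuclideanSpace ℝ (Fin d)) → (ℝ → EuclideanSpace ℝ (Fin d))) (C : ℝ≥0) : Prop :=
  ∀ f : ℝ → EuclideanSpace ℝ (Fin d), MemLp f 2 μ → normLpW μ p W f < ∞ →
    normLpW μ p W (T f) ≤ C * normLpW μ p W f

/-- `c_p^b(Q, R)`. -/
def cpb (D : DyadicGrid) (μ : Measure ℝ) (p : ℝ) (Q R : Idx) : ℝ :=
  if Q = R then 1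
  else mQ D μ Q ^ (p / 2) * mQ D μ R ^ (p / 2) /
    (μ.real (D.interval R) * μ.real (D.interval Q) ^ (p - 1))

/-- The characteristic `[W]_{A_p^N}`, with `p' = p / (p - 1)` and the operator norm of matrices. -/
def ApN {d : ℕ} (D : DyadicGrid) (μ : Measure ℝ) (p : ℝ) (N : ℕ)
    (W : ℝ → Matrix (Fin d) (Fin d) ℝ) : ℝ≥0∞ :=
  ⨆ (Q : Idx) (R : Idx) (_ : D.dist Q R ≤ ((N + 2 : ℕ) : ℕ∞)),
    ENNReal.ofReal (cpb D μ p Q R) *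
      ⨍⁻ x in D.interval Q,
        (⨍⁻ y in D.interval R,
          ‖Matrix.toEuclideanCLM (n := Fin d) (𝕜 := ℝ)
            (matPow (W x) (1 / p) * matPow (W y) (-(1 / p)))‖ₑ ^ (p / (p - 1)) ∂μ) ^
            (p / (p / (p - 1))) ∂μ

end

end HaarShift

/-! Very simple shifts suffice for testing. If the parents `Q̂`, `R̂` lie `a` and `b` generations
below a common ancestor and `a + b ≤ N`, then `f ↦ ⟨f, h_R̂⟩ h_Q̂` is a Haar shift of complexity
`(b, a)`. Both Haar functions are constant, up to sign, on `R` and on `Q`, so for `f` supported in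
`R` the operator equals, on `Q`, a constant of modulus `√(m(Q̂) m(R̂)) / (μ(Q) μ(R))` times `∫_R f`.
Hence integration over `R`, viewed as a map into constants on `Q`, is bounded in `L^p(W)`
(`integralBound_of_parents`), and balance replaces the parents by `Q` and `R`.

For `Q = R`, the shift of complexity `(0, 0)` that sums `⟨f, h_L⟩ h_L` over finitely many strict
ancestors `L` telescopes to `1/μ(Q) - 1/μ(Q')` times `∫_Q f`, with `Q'` the last of them. As
quadrants have infinite measure, `Q'` can be chosen with `μ(Q') ≥ 2 μ(Q)` (`integralBound_self`).
Nested pairs follow from the bound for the larger interval.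

It remains to pass from such bounds to the `A_p` integral, which carries the operator norm inside
(`mixed_norm_le`). An Auerbach system `u_i`, `φ_i` of the norm `u ↦ ‖W^{1/p} u‖_{L^p(Q)}` on `ℝ^d`
gives `|W(x)^{1/p} W(y)^{-1/p}| ≤ ∑ |W(x)^{1/p} u_i| |W(y)^{-1/p} φ_i|`. The first factors have
`L^p` norm at most 1 and the second are controlled in `L^{p'}` by duality. -/

namespace HaarShift

/-! ### Auerbach systems of finite-dimensional norms -/

section Auerbach

open Module

/-- Auerbach's lemma, by maximizing a determinant over the unit ball. -/
theorem exists_auerbach_basis (V : Type*) [NormedAddCommGroup V] [NormedSpace ℝ V]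
    [FiniteDimensional ℝ V] :
    ∃ b : Basis (Fin (finrank ℝ V)) ℝ V, (∀ i, ‖b i‖ ≤ 1) ∧ ∀ i v, |b.repr v i| ≤ ‖v‖ := by
  classical
  set b₀ : Basis (Fin (finrank ℝ V)) ℝ V := finBasis ℝ V
  have : ProperSpace V := FiniteDimensional.proper ℝ V
  have hcont : Continuous fun u : Fin (finrank ℝ V) → V => |b₀.det u| := by
    have h : Continuous fun u : Fin (finrank ℝ V) → V => b₀.toMatrix u := by
      refine continuous_matrix fun i j => ?_
      exact (LinearMap.continuous_of_finiteDimensional (b₀.coord i)).comp (continuous_apply j)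
    simpa only [Basis.det_apply] using h.matrix_det.abs
  obtain ⟨u, hu, hmax⟩ := (isCompact_closedBall (0 : Fin (finrank ℝ V) → V) 1).exists_isMaxOn
    ⟨0, by simp⟩ hcont.continuousOn
  have hball : ∀ w : Fin (finrank ℝ V) → V,
      w ∈ Metric.closedBall 0 1 ↔ ∀ i, ‖w i‖ ≤ 1 := fun w => by
    rw [mem_closedBall_zero_iff, pi_norm_le_iff_of_nonneg zero_le_one]
  rw [hball] at hu
  have hpos : 0 < |b₀.det u| := by
    set w : Fin (finrank ℝ V) → V := fun i => ‖b₀ i‖⁻¹ • b₀ i with hw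
    have hw1 : w ∈ Metric.closedBall 0 1 := by
      rw [hball]; intro i
      simp only [hw, norm_smul, norm_inv, norm_norm]
      exact (inv_mul_cancel₀ (norm_ne_zero_iff.2 (b₀.ne_zero i))).le
    refine lt_of_lt_of_le ?_ (show |b₀.det w| ≤ |b₀.det u| from hmax hw1)
    rw [hw, AlternatingMap.map_smul_univ, Basis.det_self]
    simp only [smul_eq_mul, mul_one, abs_pos]
    exact Finset.prod_ne_zero_iff.2 fun i _ => inv_ne_zero (norm_ne_zero_iff.2 (b₀.ne_zero i))
  obtain ⟨hli, hsp⟩ := (b₀.is_basis_iff_det (v := u)).2 (isUnit_iff_ne_zero.2 (abs_pos.1 hpos))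
  refine ⟨Basis.mk hli hsp.ge, fun i => by simpa using hu i, fun i v => ?_⟩
  set b := Basis.mk hli hsp.ge
  have hb : ∀ j, b j = u j := fun j => by simp [b]
  -- Cramer's rule: the coordinates are quotients of determinants, so maximality of `|det u|` bounds
  -- them by 1 on the unit ball.
  have hcoord : ∀ v, b₀.det (Function.update u i v) = b.repr v i * b₀.det u := by
    intro v
    conv_lhs => rw [← b.sum_repr v]
    rw [AlternatingMap.map_update_sum, Finset.sum_eq_single i]
    · rw [AlternatingMap.map_update_smul, hb, Function.update_eq_self, smul_eq_mul]
    · intro j _ hj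
      rw [AlternatingMap.map_update_smul, hb, b₀.det.map_update_self u hj.symm, smul_zero]
    · simp
  rcases eq_or_ne v 0 with rfl | hv
  · simp
  have hv' : 0 < ‖v‖ := norm_pos_iff.2 hv
  have key : |b.repr (‖v‖⁻¹ • v) i| ≤ 1 := by
    have h1 : Function.update u i (‖v‖⁻¹ • v) ∈ Metric.closedBall 0 1 := by
      rw [hball]; intro j
      rcases eq_or_ne j i with rfl | hj
      · rw [Function.update_self, norm_smul, norm_inv, norm_norm, inv_mul_cancel₀ hv'.ne']
      · rw [Function.update_of_ne hj]; exact hu j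
    have h2 : |b₀.det (Function.update u i (‖v‖⁻¹ • v))| ≤ |b₀.det u| := hmax h1
    rw [hcoord, abs_mul] at h2
    exact (mul_le_iff_le_one_left hpos).1 h2
  rw [map_smul, Finsupp.smul_apply, smul_eq_mul, abs_mul, abs_inv, abs_norm,
    inv_mul_le_iff₀ hv', mul_one] at key
  exact key

/-- A norm `v ↦ ‖Φ v‖` on a Euclidean space has an Auerbach system. -/
theorem exists_auerbach_system {E F : Type*} [NormedAddCommGroup E] [InnerProductSpace ℝ E]
    [FiniteDimensional ℝ E] [NormedAddCommGroup F] [NormedSpace ℝ F] (Φ : E →ₗ[ℝ] F)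
    (hΦ : Function.Injective Φ) :
    ∃ u φ : Fin (finrank ℝ E) → E, (∀ i, ‖Φ (u i)‖ ≤ 1) ∧
      (∀ i v, |inner ℝ (φ i) v| ≤ ‖Φ v‖) ∧ ∀ v, ∑ i, inner ℝ (φ i) v • u i = v := by
  set e := LinearEquiv.ofInjective Φ hΦ with he
  have hfin : FiniteDimensional ℝ (LinearMap.range Φ) := inferInstance
  obtain ⟨b, hb1, hb2⟩ : ∃ b : Basis (Fin (finrank ℝ E)) ℝ (LinearMap.range Φ),
      (∀ i, ‖b i‖ ≤ 1) ∧ ∀ i v, |b.repr v i| ≤ ‖v‖ := by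
    rw [e.finrank_eq]
    exact exists_auerbach_basis (LinearMap.range Φ)
  refine ⟨fun i => e.symm (b i), fun i => (InnerProductSpace.toDual ℝ E).symm
    (LinearMap.toContinuousLinearMap ((b.coord i).comp e.toLinearMap)), fun i => ?_, fun i v => ?_,
    fun v => ?_⟩
  · have h : Φ (e.symm (b i)) = (b i : F) := by
      rw [← LinearEquiv.ofInjective_apply (h := hΦ) (f := Φ), ← he, e.apply_symm_apply]
    rw [h]; exact hb1 i
  · rw [InnerProductSpace.toDual_symm_apply]
    exact hb2 i (e v)
  · apply e.injective
    simp only [InnerProductSpace.toDual_symm_apply, map_sum, map_smul, LinearEquiv.apply_symm_apply]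
    exact b.sum_repr (e v)

end Auerbach

/-! ### Real powers of a matrix weight: measurability and integrability -/

section MatrixPower

open Matrix Polynomial

variable {d : ℕ}

theorem cfc_apply_eq_sum {A : Matrix (Fin d) (Fin d) ℝ} (hA : A.IsHermitian) (f : ℝ → ℝ)
    (i j : Fin d) :
    cfc f A i j = ∑ k, hA.eigenvectorUnitary.1 i k * f (hA.eigenvalues k) *
      hA.eigenvectorUnitary.1 j k := by
  rw [hA.cfc_eq, Matrix.IsHermitian.cfc, Unitary.conjStarAlgAut_apply, Matrix.mul_apply]
  refine Finset.sum_congr rfl fun k _ => ?_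
  rw [Matrix.mul_diagonal]
  simp [Matrix.star_apply]

theorem abs_eigenvectorUnitary_le_one {A : Matrix (Fin d) (Fin d) ℝ} (hA : A.IsHermitian)
    (i k : Fin d) : |hA.eigenvectorUnitary.1 i k| ≤ 1 := by
  simpa using entry_norm_bound_of_unitary hA.eigenvectorUnitary.2 i k

/-- Each eigenvalue is at most the trace, and eigenvector entries are at most 1. This reduces
integrability of powers of `W` to that of the scalar function `tr W`. -/
theorem abs_matPow_le {A : Matrix (Fin d) (Fin d) ℝ} (hA : A.PosDef) {r : ℝ} (hr : 0 ≤ r)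
    (i j : Fin d) : |matPow A r i j| ≤ d * A.trace ^ r := by
  rw [matPow, cfc_apply_eq_sum hA.isHermitian]
  refine (Finset.abs_sum_le_sum_abs _ _).trans ?_
  have htr : A.trace = ∑ k, hA.isHermitian.eigenvalues k := by
    simpa using hA.isHermitian.trace_eq_sum_eigenvalues
  have hk : ∀ k, |hA.isHermitian.eigenvectorUnitary.1 i k * hA.isHermitian.eigenvalues k ^ r *
      hA.isHermitian.eigenvectorUnitary.1 j k| ≤ A.trace ^ r := by
    intro k
    have h0 : 0 ≤ hA.isHermitian.eigenvalues k := (hA.eigenvalues_pos k).le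
    have h1 : hA.isHermitian.eigenvalues k ^ r ≤ A.trace ^ r := by
      refine Real.rpow_le_rpow h0 ?_ hr
      rw [htr]
      exact Finset.single_le_sum (f := hA.isHermitian.eigenvalues)
        (fun l _ => (hA.eigenvalues_pos l).le) (Finset.mem_univ k)
    have h2 := abs_eigenvectorUnitary_le_one hA.isHermitian i k
    have h3 := abs_eigenvectorUnitary_le_one hA.isHermitian j k
    rw [abs_mul, abs_mul, abs_of_nonneg (Real.rpow_nonneg h0 r)]
    have h4 := Real.rpow_nonneg h0 r
    calc _ ≤ 1 * hA.isHermitian.eigenvalues k ^ r * 1 := by gcongr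
      _ ≤ _ := by simpa using h1
  calc _ ≤ ∑ _k : Fin d, A.trace ^ r := Finset.sum_le_sum fun k _ => hk k
    _ = _ := by simp

theorem isHermitian_matPow (A : Matrix (Fin d) (Fin d) ℝ) (r : ℝ) : (matPow A r).IsHermitian :=
  cfc_predicate (p := IsSelfAdjoint) _ A

theorem matPow_mul_matPow_neg {A : Matrix (Fin d) (Fin d) ℝ} (hA : A.PosDef) (r : ℝ) :
    matPow A r * matPow A (-r) = 1 := by
  have hfin : (spectrum ℝ A).Finite := Matrix.finite_real_spectrum
  rw [matPow, matPow, ← cfc_mul (fun t : ℝ => t ^ r) (fun t : ℝ => t ^ (-r)) A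
    (hfin.continuousOn _) (hfin.continuousOn _), ← cfc_one (R := ℝ) (a := A)
    (ha := hA.isHermitian)]
  refine cfc_congr fun t ht => ?_
  rw [hA.isHermitian.spectrum_real_eq_range_eigenvalues] at ht
  obtain ⟨k, rfl⟩ := ht
  simp only [Pi.one_apply]
  rw [← Real.rpow_add (hA.eigenvalues_pos k), add_neg_cancel, Real.rpow_zero]

/-- Weierstrass approximation on the intervals `[1/(n+1), n+1]`, which exhaust the positive
half-line. It makes powers of `W` limits of polynomials in `W`, so measurability needs no measurable
choice of eigenvectors. -/
theorem exists_polynomial_tendsto_rpow (r : ℝ) :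
    ∃ q : ℕ → ℝ[X], ∀ t : ℝ, 0 < t → Tendsto (fun n => (q n).eval t) atTop (𝓝 (t ^ r)) := by
  have h : ∀ n : ℕ, ∃ q : ℝ[X], ∀ t ∈ Icc (1 / ((n : ℝ) + 1)) (n + 1),
      |q.eval t - t ^ r| < 1 / ((n : ℝ) + 1) := fun n => by
    refine exists_polynomial_near_of_continuousOn _ _ _ (fun t ht => ?_) _ (by positivity)
    have : 0 < t := lt_of_lt_of_le (by positivity) ht.1
    exact (Real.continuousAt_rpow_const t r (Or.inl this.ne')).continuousWithinAt
  choose q hq using h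
  refine ⟨q, fun t ht => ?_⟩
  rw [tendsto_iff_dist_tendsto_zero]
  refine squeeze_zero' (Eventually.of_forall fun _ => dist_nonneg) ?_
    tendsto_one_div_add_atTop_nhds_zero_nat
  obtain ⟨m, hm⟩ := exists_nat_ge (max t t⁻¹)
  filter_upwards [eventually_ge_atTop m] with n hn
  have hmn : (m : ℝ) ≤ n := by exact_mod_cast hn
  refine (hq n t ⟨?_, ?_⟩).le
  · rw [one_div]
    refine inv_le_of_inv_le₀ ht ?_
    linarith [le_max_right t t⁻¹]
  · linarith [le_max_left t t⁻¹]

theorem aemeasurable_matPow {μ : Measure ℝ} {W : ℝ → Matrix (Fin d) (Fin d) ℝ}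
    (hW : ∀ i j, AEMeasurable (fun x => W x i j) μ) (hpos : ∀ᵐ x ∂μ, (W x).PosDef) (r : ℝ)
    (i j : Fin d) : AEMeasurable (fun x => matPow (W x) r i j) μ := by
  obtain ⟨q, hq⟩ := exists_polynomial_tendsto_rpow r
  have hpow : ∀ (n : ℕ) (i j : Fin d), AEMeasurable (fun x => (W x ^ n) i j) μ := by
    intro n
    induction n with
    | zero => intro i j; simp only [pow_zero]; exact aemeasurable_const
    | succ n ih =>
      intro i j
      simp only [pow_succ, Matrix.mul_apply]
      exact Finset.aemeasurable_fun_sum _ fun k _ => (ih i k).mul (hW k j)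
  refine aemeasurable_of_tendsto_metrizable_ae atTop
    (f := fun n x => (aeval (W x) (q n)) i j) (fun n => ?_) ?_
  · simp only [aeval_eq_sum_range, Matrix.sum_apply, Matrix.smul_apply, smul_eq_mul]
    exact Finset.aemeasurable_fun_sum _ fun k _ => (hpow k i j).const_mul _
  · filter_upwards [hpos] with x hx
    have h1 : ∀ n, aeval (W x) (q n) = cfc (q n).eval (W x) := fun n =>
      (cfc_polynomial (q n) (W x) hx.isHermitian).symm
    simp only [h1, matPow, cfc_apply_eq_sum hx.isHermitian]
    refine tendsto_finsetSum _ fun k _ => ?_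
    exact ((hq _ (hx.eigenvalues_pos k)).const_mul _).mul_const _

/-- The operator `W(x)^r` on `ℝ^d`. -/
noncomputable def powOp (W : ℝ → Matrix (Fin d) (Fin d) ℝ) (r : ℝ) (x : ℝ) :
    EuclideanSpace ℝ (Fin d) →L[ℝ] EuclideanSpace ℝ (Fin d) :=
  Matrix.toEuclideanCLM (n := Fin d) (𝕜 := ℝ) (matPow (W x) r)

theorem exists_toEuclideanCLM_eq_sum (d : ℕ) :
    ∃ G : Fin d → Fin d → EuclideanSpace ℝ (Fin d) →L[ℝ] EuclideanSpace ℝ (Fin d),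
      ∀ A : Matrix (Fin d) (Fin d) ℝ,
        Matrix.toEuclideanCLM (n := Fin d) (𝕜 := ℝ) A = ∑ i, ∑ j, A i j • G i j := by
  refine ⟨fun i j => Matrix.toEuclideanCLM (n := Fin d) (𝕜 := ℝ) (Matrix.single i j 1),
    fun A => ?_⟩
  conv_lhs => rw [Matrix.matrix_eq_sum_single A]
  simp only [map_sum, ← map_smul, Matrix.smul_single, smul_eq_mul, mul_one]

theorem aestronglyMeasurable_powOp {μ : Measure ℝ} {W : ℝ → Matrix (Fin d) (Fin d) ℝ}
    (hW : IsMatrixWeight μ W) (r : ℝ) : AEStronglyMeasurable (powOp W r) μ := by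
  have h := aemeasurable_matPow
    (fun i j => (hW.locallyIntegrable i j).aestronglyMeasurable.aemeasurable) hW.posDef r
  obtain ⟨G, hG⟩ := exists_toEuclideanCLM_eq_sum d
  have : powOp W r = fun x => ∑ i, ∑ j, matPow (W x) r i j • G i j :=
    funext fun x => hG _
  rw [this]
  exact Finset.aestronglyMeasurable_fun_sum _ fun i _ =>
    Finset.aestronglyMeasurable_fun_sum _ fun j _ =>
      (h i j).aestronglyMeasurable.smul_const _

theorem memLp_double_sum {F : Type*} [NormedAddCommGroup F] {μ : Measure ℝ} {q : ℝ≥0∞}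
    {f : Fin d → Fin d → ℝ → F} (hf : ∀ i j, MemLp (f i j) q μ) :
    MemLp (fun x => ∑ i, ∑ j, f i j x) q μ :=
  memLp_finsetSum _ fun i _ => memLp_finsetSum _ fun j _ => hf i j

/-- The entries of `W^{1/p}` are dominated by `d (tr W)^{1/p}`, whose `p`-th power is integrable on
`Q`. -/
theorem memLp_powOp {μ : Measure ℝ} {W : ℝ → Matrix (Fin d) (Fin d) ℝ}
    (hW : IsMatrixWeight μ W) {p : ℝ} (hp : 0 < p) {Q : Set ℝ}
    (hQ : ∀ i j, IntegrableOn (fun x => W x i j) Q μ) :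
    MemLp (powOp W (1 / p)) (ENNReal.ofReal p) (μ.restrict Q) := by
  have h := aemeasurable_matPow
    (fun i j => (hW.locallyIntegrable i j).aestronglyMeasurable.aemeasurable) hW.posDef (1 / p)
  obtain ⟨G, hG⟩ := exists_toEuclideanCLM_eq_sum d
  have : powOp W (1 / p) = fun x => ∑ i, ∑ j, matPow (W x) (1 / p) i j • G i j :=
    funext fun x => hG _
  rw [this]
  have htr : Integrable (fun x => (W x).trace) (μ.restrict Q) := by
    simp only [Matrix.trace]
    exact integrable_finsetSum _ fun i _ => hQ i i
  have hptr : ∀ᵐ x ∂μ.restrict Q, (W x).PosDef := ae_restrict_of_ae hW.posDef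
  have hp0 : ENNReal.ofReal p ≠ 0 := by simpa using hp
  have hLp : MemLp (fun x => (d : ℝ) * (W x).trace ^ (1 / p)) (ENNReal.ofReal p)
      (μ.restrict Q) := by
    refine MemLp.const_mul ?_ _
    rw [← integrable_norm_rpow_iff _ hp0 ENNReal.ofReal_ne_top, ENNReal.toReal_ofReal hp.le]
    · refine htr.congr ?_
      filter_upwards [hptr] with x hx
      have h0 : 0 ≤ (W x).trace := hx.posSemidef.trace_nonneg
      rw [Real.norm_of_nonneg (Real.rpow_nonneg h0 _), ← Real.rpow_mul h0,
        one_div_mul_cancel hp.ne', Real.rpow_one]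
    · exact (htr.aestronglyMeasurable.aemeasurable.pow_const _).aestronglyMeasurable
  have hij (i j : Fin d) : MemLp (fun x => matPow (W x) (1 / p) i j • G i j) (ENNReal.ofReal p)
      (μ.restrict Q) := by
    refine (hLp.mul_const ‖G i j‖).mono'
      ((h i j).restrict.aestronglyMeasurable.smul_const _) ?_
    filter_upwards [hptr] with x hx
    rw [norm_smul]
    exact mul_le_mul_of_nonneg_right (abs_matPow_le hx (by positivity) i j) (norm_nonneg _)
  exact memLp_double_sum hij

theorem powOp_mul_powOp_neg {μ : Measure ℝ} {W : ℝ → Matrix (Fin d) (Fin d) ℝ}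
    (hW : IsMatrixWeight μ W) (r : ℝ) : ∀ᵐ x ∂μ, powOp W r x * powOp W (-r) x = 1 := by
  filter_upwards [hW.posDef] with x hx
  rw [powOp, powOp, ← map_mul, matPow_mul_matPow_neg hx, map_one]

theorem inner_powOp (W : ℝ → Matrix (Fin d) (Fin d) ℝ) (r x : ℝ)
    (u v : EuclideanSpace ℝ (Fin d)) :
    inner ℝ (powOp W r x u) v = inner ℝ u (powOp W r x v) := by
  have h : IsSelfAdjoint (powOp W r x) := by
    rw [IsSelfAdjoint, powOp, ← map_star]
    congr 1
    exact isHermitian_matPow (W x) r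
  exact (ContinuousLinearMap.isSelfAdjoint_iff_isSymmetric.1 h) u v

end MatrixPower

/-! ### Duality and the mixed norm of `A(x) B(y)` -/

section Duality

open Module

variable {α β E : Type*} [MeasurableSpace α] [MeasurableSpace β] [NormedAddCommGroup E]
  [InnerProductSpace ℝ E]

/-- Duality: a bound for the functional `f ↦ ⟪φ, ∫ f⟫` in the `A`-weighted `L^p` norm bounds the
`L^{p'}` norm of `B φ`, where `B = A⁻¹`. -/
theorem eLpNorm'_le_of_inner_integral_le [CompleteSpace E] {ν : Measure β} [IsFiniteMeasure ν]
    {p : ℝ} (hp : 1 < p) {A B : β → E →L[ℝ] E} (hB : AEStronglyMeasurable B ν)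
    (hAB : ∀ᵐ y ∂ν, A y * B y = 1) (hsym : ∀ y u v, inner ℝ (B y u) v = inner ℝ u (B y v))
    (φ : E) (M : ℝ≥0∞)
    (h : ∀ f : β → E, AEStronglyMeasurable f ν → (∃ K, ∀ y, ‖f y‖ ≤ K) →
      eLpNorm' (fun y => A y (f y)) p ν < ∞ →
      ENNReal.ofReal (inner ℝ φ (∫ y, f y ∂ν)) ≤ M * eLpNorm' (fun y => A y (f y)) p ν) :
    eLpNorm' (fun y => B y φ) (p / (p - 1)) ν ≤ M := by
  have hp0 : 0 < p := by linarith
  have hp1 : 0 < p - 1 := by linarith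
  set q := p / (p - 1) with hq
  have hq1 : 1 < q := by rw [hq, lt_div_iff₀ hp1]; linarith
  have hq0 : 0 < q := by linarith
  have hpq : (q - 1) * p = q := by rw [hq]; field_simp; ring
  have hpq' : 1 / p + 1 / q = 1 := by rw [hq]; field_simp; ring
  set g : β → E := fun y => B y φ with hg
  have hgm : AEStronglyMeasurable g ν := hB.apply_continuousLinearMap φ
  -- Truncation to where `‖B‖ ≤ n`: it makes the test functions bounded and the integrals `I n`
  -- finite, although `‖B φ‖_q` is not yet known to be finite.
  set S : ℕ → Set β := fun n => {y | ‖B y‖ ≤ n} with hS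
  have hSm : ∀ n, NullMeasurableSet (S n) ν := fun n =>
    nullMeasurableSet_le hB.norm.aemeasurable aemeasurable_const
  have hgS : ∀ n, ∀ y ∈ S n, ‖g y‖ ≤ n * ‖φ‖ := fun n y hy =>
    (B y).le_of_opNorm_le hy φ
  have hpow : ∀ v : E, ‖v‖ ^ (q - 2) * ‖v‖ = ‖v‖ ^ (q - 1) := by
    intro v
    rcases (norm_nonneg v).eq_or_lt with h0 | h0
    · rw [← h0, mul_zero, Real.zero_rpow (by linarith)]
    · rw [show q - 1 = q - 2 + 1 by ring, Real.rpow_add_one h0.ne']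
  have hpow' : ∀ v : E, ‖v‖ ^ (q - 1) * ‖v‖ = ‖v‖ ^ q := by
    intro v
    rcases (norm_nonneg v).eq_or_lt with h0 | h0
    · rw [← h0, mul_zero, Real.zero_rpow hq0.ne']
    · rw [show q = q - 1 + 1 by ring, Real.rpow_add_one h0.ne']; simp
  -- The extremizer of Hölder's inequality: `A f = |g|^{q-2} g` on `S n`, so both `⟪φ, ∫ f⟫` and `‖A
  -- f‖_p^p` equal `∫_{S n} |g|^q`. The exponent `q - 2` may be negative, which is harmless because
  -- a factor `|g|` always accompanies it.
  set f : ℕ → β → E := fun n => (S n).indicator fun y => ‖g y‖ ^ (q - 2) • B y (g y) with hf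
  have hfm : ∀ n, AEStronglyMeasurable (f n) ν := fun n => by
    refine AEStronglyMeasurable.indicator₀ ?_ (hSm n)
    refine AEStronglyMeasurable.smul
      (hgm.norm.aemeasurable.pow_const _).aestronglyMeasurable ?_
    exact (ContinuousLinearMap.apply ℝ E : E →L[ℝ] (E →L[ℝ] E) →L[ℝ] E).aestronglyMeasurable_comp₂
      hgm hB
  have hfb : ∀ n, ∃ K, ∀ y, ‖f n y‖ ≤ K := fun n => by
    refine ⟨(n * ‖φ‖) ^ (q - 1) * n, fun y => ?_⟩
    have h0 : 0 ≤ ((n : ℝ) * ‖φ‖) ^ (q - 1) * n := by positivity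
    simp only [hf]
    by_cases hy : y ∈ S n
    · rw [indicator_of_mem hy, norm_smul, Real.norm_of_nonneg (by positivity)]
      calc ‖g y‖ ^ (q - 2) * ‖B y (g y)‖ ≤ ‖g y‖ ^ (q - 2) * (n * ‖g y‖) := by
            gcongr; exact (B y).le_of_opNorm_le hy _
        _ = ‖g y‖ ^ (q - 1) * n := by rw [← hpow]; ring
        _ ≤ _ := by
            gcongr
            exact hgS n y hy
    · rw [indicator_of_notMem hy, norm_zero]; exact h0
  set I : ℕ → ℝ≥0∞ := fun n => ∫⁻ y, (S n).indicator (fun y => ‖g y‖ₑ ^ q) y ∂ν with hI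
  have hIreal : ∀ n y, (S n).indicator (fun y => ‖g y‖ₑ ^ q) y =
      ENNReal.ofReal ((S n).indicator (fun y => ‖g y‖ ^ q) y) := fun n y => by
    by_cases hy : y ∈ S n
    · rw [indicator_of_mem hy, indicator_of_mem hy,
        ← ENNReal.ofReal_rpow_of_nonneg (norm_nonneg _) hq0.le, ofReal_norm]
    · rw [indicator_of_notMem hy, indicator_of_notMem hy, ENNReal.ofReal_zero]
  have hint : ∀ n, Integrable ((S n).indicator fun y => ‖g y‖ ^ q) ν := fun n => by
    refine Integrable.of_bound (C := (n * ‖φ‖) ^ q)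
      ((hgm.norm.aemeasurable.pow_const _).aestronglyMeasurable.indicator₀ (hSm n))
      (Eventually.of_forall fun y => ?_)
    have h0 : 0 ≤ ((n : ℝ) * ‖φ‖) ^ q := by positivity
    by_cases hy : y ∈ S n
    · rw [indicator_of_mem hy, Real.norm_of_nonneg (by positivity)]
      gcongr
      exact hgS n y hy
    · rw [indicator_of_notMem hy, norm_zero]; exact h0
  have hnn : ∀ n y, 0 ≤ (S n).indicator (fun y => ‖g y‖ ^ q) y := fun n y =>
    indicator_nonneg (fun y _ => by positivity) y
  have hIeq : ∀ n, I n = ENNReal.ofReal (∫ y, (S n).indicator (fun y => ‖g y‖ ^ q) y ∂ν) :=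
    fun n => by
      rw [ofReal_integral_eq_lintegral_ofReal (hint n) (Eventually.of_forall (hnn n))]
      exact lintegral_congr (hIreal n)
  have hItop : ∀ n, I n ≠ ∞ := fun n => by rw [hIeq]; exact ENNReal.ofReal_ne_top
  have hnorm : ∀ n, eLpNorm' (fun y => A y (f n y)) p ν = I n ^ (1 / p) := fun n => by
    rw [eLpNorm'_eq_lintegral_enorm]
    congr 1
    refine lintegral_congr_ae ?_
    filter_upwards [hAB] with y hy
    rw [hIreal]
    by_cases hyS : y ∈ S n
    · have h1 : A y (B y (g y)) = g y := by
        rw [← mul_apply_eq_comp, hy, one_apply_eq_self]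
      simp only [hf, indicator_of_mem hyS, map_smul, h1]
      rw [← ofReal_norm, norm_smul, Real.norm_of_nonneg (by positivity), hpow,
        ENNReal.ofReal_rpow_of_nonneg (by positivity) hp0.le, ← Real.rpow_mul (norm_nonneg _), hpq]
    · simp only [hf, indicator_of_notMem hyS, map_zero, enorm_zero, ENNReal.ofReal_zero]
      exact ENNReal.zero_rpow_of_pos hp0
  have hinner : ∀ n, inner ℝ φ (∫ y, f n y ∂ν) =
      ∫ y, (S n).indicator (fun y => ‖g y‖ ^ q) y ∂ν := fun n => by
    obtain ⟨K, hK⟩ := hfb n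
    rw [← integral_inner (Integrable.of_bound (hfm n) K (Eventually.of_forall hK))]
    refine integral_congr_ae (Eventually.of_forall fun y => ?_)
    by_cases hyS : y ∈ S n
    · simp only [hf, indicator_of_mem hyS]
      rw [inner_smul_right, ← hsym, real_inner_self_eq_norm_sq, ← hpow', ← hpow]
      ring
    · simp only [hf, indicator_of_notMem hyS, inner_zero_right]
  have hle : ∀ n, I n ≤ M ^ q := fun n => by
    have h1 := h (f n) (hfm n) (hfb n) (by
      rw [hnorm]; exact ENNReal.rpow_lt_top_of_nonneg (by positivity) (hItop n))
    rw [hinner, ← hIeq, hnorm] at h1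
    -- Now `I ≤ M I^{1/p}`; dividing by `I^{1/p}`, which is finite and nonzero in the second case,
    -- leaves `I^{1/q} ≤ M`.
    rcases eq_or_ne (I n) 0 with h0 | h0
    · rw [h0]; exact zero_le
    · have h2 : I n = I n ^ (1 / q) * I n ^ (1 / p) := by
        rw [← ENNReal.rpow_add _ _ h0 (hItop n), add_comm, hpq', ENNReal.rpow_one]
      have h3 : I n ^ (1 / p) ≠ 0 := by simp [h0, hItop n]
      have h4 : I n ^ (1 / p) ≠ ∞ := ENNReal.rpow_ne_top_of_nonneg (by positivity) (hItop n)
      nth_rewrite 1 [h2] at h1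
      have h5 := (ENNReal.mul_le_mul_iff_left h3 h4).1 h1
      have h6 := ENNReal.rpow_le_rpow h5 hq0.le
      rwa [← ENNReal.rpow_mul, one_div_mul_cancel hq0.ne', ENNReal.rpow_one] at h6
  have hlim : Tendsto I atTop (𝓝 (∫⁻ y, ‖g y‖ₑ ^ q ∂ν)) := by
    refine lintegral_tendsto_of_tendsto_of_monotone
      (fun n => (hgm.enorm.pow_const q).indicator₀ (hSm n))
      (Eventually.of_forall fun y => ?_) (Eventually.of_forall fun y => ?_)
    · intro m n hmn
      refine indicator_le_indicator_of_subset (fun z hz => ?_) (fun _ => zero_le) y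
      have hz' : ‖B z‖ ≤ m := hz
      exact hz'.trans (by exact_mod_cast hmn)
    · refine tendsto_const_nhds.congr' ?_
      obtain ⟨n₀, hn₀⟩ := exists_nat_ge ‖B y‖
      filter_upwards [eventually_ge_atTop n₀] with n hn
      have : y ∈ S n := hn₀.trans (by exact_mod_cast hn)
      rw [indicator_of_mem this]
  have hfin := le_of_tendsto' hlim hle
  rw [eLpNorm'_eq_lintegral_enorm]
  calc _ ≤ (M ^ q) ^ (1 / q) := ENNReal.rpow_le_rpow hfin (by positivity)
    _ = M := by rw [← ENNReal.rpow_mul, mul_one_div_cancel hq0.ne', ENNReal.rpow_one]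

/-- The map `u ↦ A u` from vectors to `L^p`. -/
theorem exists_linearMap_Lp [FiniteDimensional ℝ E] {μ : Measure α} [NeZero μ] {p : ℝ}
    {A B : α → E →L[ℝ] E} (hp : 1 < p)
    (hA : MemLp A (ENNReal.ofReal p) μ) (hBA : ∀ᵐ x ∂μ, B x * A x = 1) :
    ∃ Φ : E →ₗ[ℝ] Lp E (ENNReal.ofReal p) μ, Function.Injective Φ ∧
      ∀ u, ENNReal.ofReal ‖Φ u‖ = eLpNorm' (fun x => A x u) p μ := by
  have hp0 : 0 < p := by linarith
  have hp0' : ENNReal.ofReal p ≠ 0 := by simpa using hp0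
  have hmem : ∀ u, MemLp (fun x => A x u) (ENNReal.ofReal p) μ := fun u =>
    (ContinuousLinearMap.apply ℝ E u).comp_memLp' hA
  refine ⟨{ toFun := fun u => (hmem u).toLp
            map_add' := fun u v => ?_
            map_smul' := fun c u => ?_ }, ?_, fun u => ?_⟩
  · rw [← MemLp.toLp_add]
    exact MemLp.toLp_congr _ _ (Eventually.of_forall fun x => by simp)
  · rw [RingHom.id_apply, ← MemLp.toLp_const_smul]
    exact MemLp.toLp_congr _ _ (Eventually.of_forall fun x => by simp)
  · rw [injective_iff_map_eq_zero]
    intro u hu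
    have h1 : (fun x => A x u) =ᵐ[μ] 0 := by
      have h2 : (hmem u).toLp = (0 : Lp E (ENNReal.ofReal p) μ) := hu
      exact ((hmem u).coeFn_toLp.symm.trans (by rw [h2])).trans (Lp.coeFn_zero _ _ _)
    -- As `μ ≠ 0`, an almost everywhere property holds at some point; there `A x` is injective.
    obtain ⟨x, hx1, hx2⟩ := (h1.and hBA).exists
    have : (B x * A x) u = 0 := by
      rw [mul_apply_eq_comp, show A x u = 0 from hx1, map_zero]
    rwa [hx2] at this
  · change ENNReal.ofReal ‖(hmem u).toLp‖ = _
    rw [Lp.norm_toLp, ENNReal.ofReal_toReal (hmem u).2.ne,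
      eLpNorm_eq_eLpNorm' hp0' ENNReal.ofReal_ne_top, ENNReal.toReal_ofReal hp0.le]

/-- If averaging is bounded in the weighted norm, then so is the mixed norm of `A(x) B(y)`. -/
theorem mixed_norm_le [FiniteDimensional ℝ E] {μ : Measure α} [NeZero μ] {ν : Measure β}
    [IsFiniteMeasure ν] {p : ℝ} (hp : 1 < p) {A A' : α → E →L[ℝ] E} {C B : β → E →L[ℝ] E}
    (hA : MemLp A (ENNReal.ofReal p) μ) (hA' : ∀ᵐ x ∂μ, A' x * A x = 1)
    (hB : AEStronglyMeasurable B ν) (hCB : ∀ᵐ y ∂ν, C y * B y = 1)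
    (hsym : ∀ y u v, inner ℝ (B y u) v = inner ℝ u (B y v)) (M : ℝ≥0∞)
    (h : ∀ f : β → E, AEStronglyMeasurable f ν → (∃ K, ∀ y, ‖f y‖ ≤ K) →
      eLpNorm' (fun y => C y (f y)) p ν < ∞ →
      eLpNorm' (fun x => A x (∫ y, f y ∂ν)) p μ ≤ M * eLpNorm' (fun y => C y (f y)) p ν) :
    ∫⁻ x, (∫⁻ y, ‖A x * B y‖ₑ ^ (p / (p - 1)) ∂ν) ^ (p / (p / (p - 1))) ∂μ ≤
      (finrank ℝ E * M) ^ p := by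
  have hp0 : 0 < p := by linarith
  have hp1 : 0 < p - 1 := by linarith
  set q := p / (p - 1) with hq
  have hq1 : 1 < q := by rw [hq, lt_div_iff₀ hp1]; linarith
  have hq0 : 0 < q := by linarith
  have : Fact (1 ≤ ENNReal.ofReal p) := ⟨by simpa using hp.le⟩
  obtain ⟨Φ, hΦ, hΦn⟩ := exists_linearMap_Lp hp hA hA'
  obtain ⟨u, φ, hu, hφ, hsum⟩ := exists_auerbach_system Φ hΦ
  -- The functional `⟪φ i, ·⟫` is dominated by the norm `‖Φ ·‖`, so the assumed vector bound becomes
  -- a scalar one and duality applies.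
  have hBφ : ∀ i, eLpNorm' (fun y => B y (φ i)) q ν ≤ M := fun i => by
    refine eLpNorm'_le_of_inner_integral_le hp hB hCB hsym (φ i) M fun f hf hb hlt => ?_
    refine le_trans ?_ (h f hf hb hlt)
    rw [← hΦn]
    exact ENNReal.ofReal_le_ofReal ((le_abs_self _).trans (hφ i _))
  have hAu : ∀ i, eLpNorm' (fun x => A x (u i)) p μ ≤ 1 := fun i => by
    rw [← hΦn, ← ENNReal.ofReal_one]
    exact ENNReal.ofReal_le_ofReal (hu i)
  have hAm : ∀ i, AEStronglyMeasurable (fun x => A x (u i)) μ := fun i =>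
    hA.1.apply_continuousLinearMap (u i)
  have hBm : ∀ i, AEStronglyMeasurable (fun y => B y (φ i)) ν := fun i =>
    hB.apply_continuousLinearMap (φ i)
  -- Expand `B(y) w` in the Auerbach system and move the symmetric `B(y)` onto `φ i`; this separates
  -- `x` from `y` with only `finrank ℝ E` terms.
  have hAB : ∀ x y, ‖A x * B y‖ ≤ ∑ i, ‖A x (u i)‖ * ‖B y (φ i)‖ := fun x y => by
    refine ContinuousLinearMap.opNorm_le_bound _ (by positivity) fun w => ?_
    rw [mul_apply_eq_comp, ← hsum (B y w), map_sum, Finset.sum_mul]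
    refine (norm_sum_le _ _).trans (Finset.sum_le_sum fun i _ => ?_)
    rw [map_smul, norm_smul, ← hsym, mul_comm, mul_assoc]
    gcongr
    exact norm_inner_le_norm _ _
  have hinner : ∀ x, (∫⁻ y, ‖A x * B y‖ₑ ^ q ∂ν) ^ (1 / q) ≤ M * ∑ i, ‖A x (u i)‖ₑ := fun x => by
    rw [← eLpNorm'_eq_lintegral_enorm (f := fun y => A x * B y)]
    calc eLpNorm' (fun y => A x * B y) q ν
        ≤ eLpNorm' (∑ i, fun y => ‖A x (u i)‖ • ‖B y (φ i)‖) q ν := by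
          refine eLpNorm'_mono_ae hq0.le (Eventually.of_forall fun y => ?_)
          rw [Finset.sum_apply]
          refine (hAB x y).trans (le_abs_self _)
      _ ≤ ∑ i, eLpNorm' (fun y => ‖A x (u i)‖ • ‖B y (φ i)‖) q ν :=
          eLpNorm'_sum_le (fun i _ => (hBm i).norm.const_mul _) hq1.le
      _ ≤ ∑ i, M * ‖A x (u i)‖ₑ := by
          refine Finset.sum_le_sum fun i _ => ?_
          have h1 : eLpNorm' (fun y => ‖A x (u i)‖ • ‖B y (φ i)‖) q ν =
              ‖A x (u i)‖ₑ * eLpNorm' (fun y => B y (φ i)) q ν := by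
            have := eLpNorm'_const_smul (μ := ν) (f := fun y => ‖B y (φ i)‖) ‖A x (u i)‖ hq0
            rw [eLpNorm'_norm, enorm_norm] at this
            exact this
          rw [h1, mul_comm]
          gcongr
          exact hBφ i
      _ = _ := by rw [Finset.mul_sum]
  calc _ ≤ ∫⁻ x, M ^ p * ‖∑ i, ‖A x (u i)‖‖ₑ ^ p ∂μ := by
        refine lintegral_mono fun x => ?_
        have h1 : (p / q : ℝ) = 1 / q * p := by ring
        have h2 : ‖∑ i, ‖A x (u i)‖‖ₑ = ∑ i, ‖A x (u i)‖ₑ := by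
          rw [Real.enorm_of_nonneg (by positivity), ENNReal.ofReal_sum_of_nonneg fun i _ => norm_nonneg _]
          simp only [ofReal_norm]
        simp only
        rw [h1, ENNReal.rpow_mul, h2, ← ENNReal.mul_rpow_of_nonneg _ _ hp0.le]
        exact ENNReal.rpow_le_rpow (hinner x) hp0.le
    _ = M ^ p * eLpNorm' (∑ i, fun x => ‖A x (u i)‖) p μ ^ p := by
        rw [lintegral_const_mul'']
        · rw [← lintegral_rpow_enorm_eq_rpow_eLpNorm' hp0]
          simp only [Finset.sum_apply]
        · exact (Finset.aestronglyMeasurable_fun_sum _ fun i _ =>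
            (hAm i).norm).enorm.pow_const p
    _ ≤ M ^ p * (finrank ℝ E : ℝ≥0∞) ^ p := by
        gcongr
        refine (eLpNorm'_sum_le (fun i _ => (hAm i).norm) hp.le).trans ?_
        calc _ ≤ ∑ _i : Fin (finrank ℝ E), (1 : ℝ≥0∞) := by
              refine Finset.sum_le_sum fun i _ => ?_
              rw [eLpNorm'_norm]; exact hAu i
          _ = _ := by simp
    _ = _ := by rw [← ENNReal.mul_rpow_of_nonneg _ _ hp0.le, mul_comm]

end Duality

noncomputable section

/-! ### The dyadic tree in terms of parents -/

section Grid

variable (D : DyadicGrid)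

/-- The dyadic parent of an interval. -/
def DyadicGrid.parent (Q : Idx) : Idx :=
  (Q.1 + 1, (Q.2 - D.shift Q.1) / 2)

theorem DyadicGrid.parent_leftChild (Q : Idx) : D.parent (D.leftChild Q) = Q := by
  ext
  · simp [parent, leftChild]
  · simp [parent, leftChild]

theorem DyadicGrid.parent_rightChild (Q : Idx) : D.parent (D.rightChild Q) = Q := by
  ext
  · simp [parent, rightChild]
  · simp only [parent, rightChild]; omega

theorem DyadicGrid.eq_leftChild_or_eq_rightChild (Q : Idx) :
    Q = D.leftChild (D.parent Q) ∨ Q = D.rightChild (D.parent Q) := by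
  obtain ⟨j, k⟩ := Q
  simp only [parent, leftChild, rightChild, Prod.mk.injEq, add_sub_cancel_right, true_and]
  omega

theorem DyadicGrid.mem_desc_iff {a : ℕ} {Q L : Idx} : Q ∈ D.desc a L ↔ D.parent^[a] Q = L := by
  induction a generalizing L with
  | zero => simp [desc]
  | succ a ih =>
    rw [desc, Finset.mem_union, ih, ih, Function.iterate_succ_apply']
    constructor
    · rintro (h | h)
      · rw [h, parent_leftChild]
      · rw [h, parent_rightChild]
    · rintro rfl
      exact D.eq_leftChild_or_eq_rightChild _

theorem DyadicGrid.measurableSet_interval (Q : Idx) : MeasurableSet (D.interval Q) :=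
  measurableSet_Ico

theorem DyadicGrid.interval_eq_union (Q : Idx) :
    D.interval Q = D.interval (D.leftChild Q) ∪ D.interval (D.rightChild Q) := by
  have h : (0 : ℝ) < 2 ^ Q.1 := by positivity
  rw [interval_leftChild, interval_rightChild, Ico_union_Ico_eq_Ico, interval]
  · nlinarith
  · nlinarith

theorem DyadicGrid.disjoint_children (Q : Idx) :
    Disjoint (D.interval (D.leftChild Q)) (D.interval (D.rightChild Q)) := by
  rw [interval_leftChild, interval_rightChild]
  exact Ico_disjoint_Ico_same

theorem DyadicGrid.interval_subset_parent (Q : Idx) :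
    D.interval Q ⊆ D.interval (D.parent Q) := by
  rw [D.interval_eq_union (D.parent Q)]
  rcases D.eq_leftChild_or_eq_rightChild Q with h | h
  · rw [← h]; exact subset_union_left
  · rw [← h]; exact subset_union_right

theorem DyadicGrid.interval_subset_iterate_parent (Q : Idx) (n : ℕ) :
    D.interval Q ⊆ D.interval (D.parent^[n] Q) := by
  induction n with
  | zero => exact subset_rfl
  | succ n ih =>
    rw [Function.iterate_succ_apply']
    exact ih.trans (D.interval_subset_parent _)

theorem DyadicGrid.monotone_interval_iterate_parent (Q : Idx) :
    Monotone fun n => D.interval (D.parent^[n] Q) :=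
  monotone_nat_of_le_succ fun n => by
    rw [Function.iterate_succ_apply']; exact D.interval_subset_parent _

theorem DyadicGrid.iterate_parent_fst (Q : Idx) (n : ℕ) : (D.parent^[n] Q).1 = Q.1 + n := by
  induction n with
  | zero => simp
  | succ n ih => rw [Function.iterate_succ_apply', parent, ih]; push_cast; ring

theorem DyadicGrid.quadrant_eq (Q : Idx) :
    D.quadrant Q = ⋃ n : ℕ, D.interval (D.parent^[n] Q) := by
  ext x
  simp only [quadrant, mem_iUnion, mem_desc_iff, exists_prop]
  constructor
  · rintro ⟨L, a, rfl, hx⟩; exact ⟨a, hx⟩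
  · rintro ⟨a, hx⟩; exact ⟨_, a, rfl, hx⟩

theorem DyadicGrid.exists_of_dist_le {Q R : Idx} {n : ℕ} (h : D.dist Q R ≤ (n : ℕ∞)) :
    ∃ a b : ℕ, a + b ≤ n ∧ D.parent^[a] Q = D.parent^[b] R := by
  have h1 : D.dist Q R < ((n + 1 : ℕ) : ℕ∞) := lt_of_le_of_lt h (by exact_mod_cast n.lt_succ_self)
  simp only [dist, iInf_lt_iff, mem_desc_iff, Nat.cast_lt] at h1
  obtain ⟨L, a, b, hQ, hR, hab⟩ := h1
  exact ⟨a, b, by omega, hQ.trans hR.symm⟩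

end Grid

/-! ### Haar functions and the balance condition -/

section Haar

variable {D : DyadicGrid} {μ : Measure ℝ}

theorem IsBalanced.real_pos (hμ : IsBalanced D μ) (Q : Idx) : 0 < μ.real (D.interval Q) :=
  ENNReal.toReal_pos (hμ.pos Q).ne' (hμ.lt_top Q).ne

theorem IsBalanced.ofReal_real (hμ : IsBalanced D μ) (Q : Idx) :
    ENNReal.ofReal (μ.real (D.interval Q)) = μ (D.interval Q) :=
  ENNReal.ofReal_toReal (hμ.lt_top Q).ne

theorem IsBalanced.mQ_pos (hμ : IsBalanced D μ) (Q : Idx) : 0 < mQ D μ Q :=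
  div_pos (mul_pos (hμ.real_pos _) (hμ.real_pos _)) (hμ.real_pos _)

theorem IsBalanced.real_eq_add (hμ : IsBalanced D μ) (Q : Idx) :
    μ.real (D.interval Q) =
      μ.real (D.interval (D.leftChild Q)) + μ.real (D.interval (D.rightChild Q)) := by
  rw [D.interval_eq_union Q, measureReal_union (D.disjoint_children Q)
    (D.measurableSet_interval _) (hμ.lt_top _).ne (hμ.lt_top _).ne]

theorem IsBalanced.mQ_le (hμ : IsBalanced D μ) (Q : Idx) : mQ D μ Q ≤ μ.real (D.interval Q) := by
  have h1 := hμ.real_pos (D.leftChild Q)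
  have h2 := hμ.real_pos (D.rightChild Q)
  rw [mQ, div_le_iff₀ (hμ.real_pos Q), hμ.real_eq_add Q]
  nlinarith

theorem IsBalanced.exists_iterate (hμ : IsBalanced D μ) :
    ∃ B : ℝ, 1 ≤ B ∧ ∀ (n : ℕ) (Q : Idx), mQ D μ Q ≤ B ^ n * mQ D μ (D.parent^[n] Q) ∧
      mQ D μ (D.parent^[n] Q) ≤ B ^ n * mQ D μ Q := by
  obtain ⟨B, hB⟩ := hμ.balanced
  -- A constant at least 1 makes its powers increasing, so one exponent can later serve all
  -- generations up to `N + 2`.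
  refine ⟨max B 1, le_max_right _ _, fun n => ?_⟩
  induction n with
  | zero => intro Q; simp
  | succ n ih =>
    intro Q
    obtain ⟨h1, h2⟩ := ih Q
    obtain ⟨h3, h4⟩ := hB (D.parent (D.parent^[n] Q)) (D.parent^[n] Q)
      ((D.mem_desc_iff).2 (by simp))
    have hm := fun R => (hμ.mQ_pos R).le
    have hB0 : 0 ≤ max B 1 := zero_le_one.trans (le_max_right _ _)
    rw [Function.iterate_succ_apply', pow_succ]
    constructor
    · calc _ ≤ _ := h1
        _ ≤ (max B 1) ^ n * (max B 1 * mQ D μ (D.parent (D.parent^[n] Q))) := by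
            gcongr
            exact h3.trans (mul_le_mul_of_nonneg_right (le_max_left _ _) (hm _))
        _ = _ := by ring
    · calc _ ≤ _ := h4
        _ ≤ max B 1 * (max B 1 ^ n * mQ D μ Q) :=
            mul_le_mul (le_max_left _ _) h2 (hm _) hB0
        _ = _ := by ring

theorem IsBalanced.memLp_haar (hμ : IsBalanced D μ) (Q : Idx) (q : ℝ≥0∞) :
    MemLp (haar D μ Q) q μ :=
  ((memLp_indicator_const q (D.measurableSet_interval _) _ (Or.inr (hμ.lt_top _).ne)).sub
    (memLp_indicator_const q (D.measurableSet_interval _) _ (Or.inr (hμ.lt_top _).ne))).const_mul _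

/-- The Haar function of the parent is constant on an interval. -/
theorem exists_haar_parent_eq (D : DyadicGrid) (μ : Measure ℝ) (Q : Idx) :
    ∃ ε : ℝ, |ε| = 1 ∧ ∀ x ∈ D.interval Q,
      haar D μ (D.parent Q) x = ε * (√(mQ D μ (D.parent Q)) / μ.real (D.interval Q)) := by
  have hd := D.disjoint_children (D.parent Q)
  rcases D.eq_leftChild_or_eq_rightChild Q with h | h <;> rw [← h] at hd
  · refine ⟨-1, by simp, fun x hx => ?_⟩
    rw [haar, ← h, indicator_of_mem hx, indicator_of_notMem (disjoint_left.1 hd hx)]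
    ring
  · refine ⟨1, by simp, fun x hx => ?_⟩
    rw [haar, ← h, indicator_of_mem hx, indicator_of_notMem (disjoint_right.1 hd hx)]
    ring

/-- The left side is the value of `h_Q̂(x) h_Q̂(y)` for `x, y ∈ Q`. Writing it as a difference lets
the sum over ancestors telescope. -/
theorem IsBalanced.mQ_parent_div (hμ : IsBalanced D μ) (Q : Idx) :
    mQ D μ (D.parent Q) / μ.real (D.interval Q) ^ 2 =
      1 / μ.real (D.interval Q) - 1 / μ.real (D.interval (D.parent Q)) := by
  have h1 := (hμ.real_pos (D.leftChild (D.parent Q))).ne'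
  have h2 := (hμ.real_pos (D.rightChild (D.parent Q))).ne'
  have h3 := (hμ.real_pos (D.parent Q)).ne'
  have h4 := hμ.real_eq_add (D.parent Q)
  rw [mQ]
  rw [h4] at h3 ⊢
  rcases D.eq_leftChild_or_eq_rightChild Q with h | h
  · rw [congrArg D.interval h]
    field_simp
    ring
  · rw [congrArg D.interval h]
    field_simp
    ring

theorem IsBalanced.exists_two_mul_le (hμ : IsBalanced D μ) (Q : Idx) :
    ∃ n : ℕ, 2 * μ.real (D.interval Q) ≤ μ.real (D.interval (D.parent^[n] Q)) := by
  have h := tendsto_measure_iUnion_atTop (μ := μ) (D.monotone_interval_iterate_parent Q)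
  rw [← D.quadrant_eq, hμ.quadrant] at h
  obtain ⟨n, hn⟩ := (h.eventually (lt_mem_nhds
    (ENNReal.mul_lt_top (by simp : (2 : ℝ≥0∞) < ∞) (hμ.lt_top Q)))).exists
  refine ⟨n, ?_⟩
  have := ENNReal.toReal_mono (hμ.lt_top _).ne hn.le
  simpa [Measure.real] using this

end Haar

/-! ### Test shifts and bounds for integration over an interval -/

section Shift

variable {D : DyadicGrid} {μ : Measure ℝ} {d : ℕ}

/-- A finite sum of rank one operators `f ↦ ⟨f, h_{j L}⟩ h_{k L}` is a Haar shift. -/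
theorem IsBalanced.isHaarShift_sum (hμ : IsBalanced D μ) {s t : ℕ} (F : Finset Idx)
    (j k : Idx → Idx) (hj : ∀ L ∈ F, j L ∈ D.desc s L) (hk : ∀ L ∈ F, k L ∈ D.desc t L) :
    IsHaarShift (d := d) D μ s t fun f x =>
      ∑ L ∈ F, haar D μ (k L) x • ∫ y in D.interval L, haar D μ (j L) y • f y ∂μ := by
  classical
  set c : Idx → Idx → Idx → ℝ := fun L J K => if L ∈ F ∧ J = j L ∧ K = k L then 1 else 0 with hc
  refine ⟨c, fun L J _ K _ => ?_, fun f hf => ⟨?_, ?_⟩⟩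
  · simp only [hc]; split_ifs <;> simp
  · refine memLp_finsetSum _ fun L _ => ?_
    exact (ContinuousLinearMap.toSpanSingleton ℝ
      (∫ y in D.interval L, haar D μ (j L) y • f y ∂μ)).comp_memLp' (hμ.memLp_haar (k L) 2)
  · have hin : ∀ L ∈ F, ∀ x, localShift D μ s t c L f x =
        haar D μ (k L) x • ∫ y in D.interval L, haar D μ (j L) y • f y ∂μ := by
      intro L hL x
      have hker : ∀ y, kernel D μ s t c L x y = haar D μ (k L) x * haar D μ (j L) y := by
        intro y
        rw [kernel, Finset.sum_eq_single_of_mem (j L) (hj L hL),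
          Finset.sum_eq_single_of_mem (k L) (hk L hL)]
        · simp [hc, hL, mul_comm]
        · intro K _ hK; simp [hc, hK]
        · intro J _ hJ; simp [hc, hJ]
      simp only [localShift, hker, mul_smul]
      exact integral_smul _ _
    have hout : ∀ L ∉ F, ∀ x, localShift D μ s t c L f x = 0 := by
      intro L hL x
      simp [localShift, kernel, hc, hL]
    -- Once `S ⊇ F` the partial sum is exactly the operator, so convergence is trivial.
    refine tendsto_const_nhds.congr' ?_
    filter_upwards [eventually_ge_atTop F] with S hS
    have : (fun x => (∑ L ∈ F, haar D μ (k L) x • ∫ y in D.interval L, haar D μ (j L) y • f y ∂μ) -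
        ∑ Q ∈ S, localShift D μ s t c Q f x) = 0 := by
      funext x
      rw [← Finset.sum_subset hS fun L _ hL => hout L hL x, Finset.sum_congr rfl
        fun L hL => hin L hL x, sub_self, Pi.zero_apply]
    rw [this, eLpNorm_zero]

theorem setIntegral_haar_smul {Q L J : Idx} (hQL : D.interval Q ⊆ D.interval L) {a : ℝ}
    (ha : ∀ y ∈ D.interval Q, haar D μ J y = a) {f : ℝ → EuclideanSpace ℝ (Fin d)}
    (hf : ∀ y ∉ D.interval Q, f y = 0) :
    ∫ y in D.interval L, haar D μ J y • f y ∂μ = a • ∫ y in D.interval Q, f y ∂μ := by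
  rw [← integral_smul]
  rw [setIntegral_eq_of_subset_of_forall_sdiff_eq_zero (D.measurableSet_interval L) hQL]
  · exact setIntegral_congr_fun (D.measurableSet_interval Q) fun y hy => by rw [ha y hy]
  · intro y hy; rw [hf y hy.2, smul_zero]

theorem normLpW_eq (μ : Measure ℝ) (p : ℝ) (W : ℝ → Matrix (Fin d) (Fin d) ℝ)
    (f : ℝ → EuclideanSpace ℝ (Fin d)) :
    normLpW μ p W f = eLpNorm' (fun x => powOp W (1 / p) x (f x)) p μ := by
  rw [eLpNorm'_eq_lintegral_enorm]; rfl

/-- Integration over `R` is bounded by `M` from functions supported in `R` to constants on `Q`, in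
the norm of `L^p(W)`. -/
def IntegralBound (μ : Measure ℝ) (p : ℝ) (W : ℝ → Matrix (Fin d) (Fin d) ℝ) (Q R : Set ℝ)
    (M : ℝ) : Prop :=
  ∀ f : ℝ → EuclideanSpace ℝ (Fin d), MemLp f 2 μ → (∀ y ∉ R, f y = 0) → normLpW μ p W f < ∞ →
    eLpNorm' (fun x => powOp W (1 / p) x (∫ y in R, f y ∂μ)) p (μ.restrict Q) ≤
      ENNReal.ofReal M * normLpW μ p W f

variable {p : ℝ} {W : ℝ → Matrix (Fin d) (Fin d) ℝ}

theorem IntegralBound.mono {Q R S : Set ℝ} {M M' : ℝ} (h : IntegralBound μ p W S S M)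
    (hp : 0 < p) (hS : MeasurableSet S) (hQ : Q ⊆ S) (hR : R ⊆ S) (hM : M ≤ M') :
    IntegralBound μ p W Q R M' := by
  intro f hf hfR hlt
  have h1 := h f hf (fun y hy => hfR y fun hy' => hy (hR hy')) hlt
  rw [setIntegral_eq_of_subset_of_forall_sdiff_eq_zero hS hR fun y hy => hfR y hy.2] at h1
  refine (eLpNorm'_mono_measure _ (Measure.restrict_mono hQ le_rfl) hp.le).trans (h1.trans ?_)
  gcongr

/-- Only the values of `T f` on `Q` are used. Here `κ` is the constant value of the kernel of `T` on
`Q × R`, and a lower bound for `|κ|` is what makes `T` a useful test. -/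
theorem integralBound_of_shift {T : (ℝ → EuclideanSpace ℝ (Fin d)) → (ℝ → EuclideanSpace ℝ (Fin d))}
    {C : ℝ≥0} (hT : BoundedOnLpW μ p W T C) (hp : 0 < p) {Q R : Set ℝ} (hQ : MeasurableSet Q)
    {κ M : ℝ} (hκ : κ ≠ 0) (hM : C ≤ |κ| * M)
    (h : ∀ f : ℝ → EuclideanSpace ℝ (Fin d), (∀ y ∉ R, f y = 0) →
      ∀ x ∈ Q, T f x = κ • ∫ y in R, f y ∂μ) :
    IntegralBound μ p W Q R M := by
  intro f hf hfR hlt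
  have h1 := hT f hf hlt
  rw [normLpW_eq μ p W (T f)] at h1
  set X := eLpNorm' (fun x => powOp W (1 / p) x (∫ y in R, f y ∂μ)) p (μ.restrict Q) with hX
  have hκ' : 0 < |κ| := abs_pos.2 hκ
  have h2 : ENNReal.ofReal |κ| * X ≤ C * normLpW μ p W f := by
    refine le_trans ?_ ((eLpNorm'_mono_measure _
      (Measure.restrict_le_self (s := Q)) hp.le).trans h1)
    have h3 : (fun x => powOp W (1 / p) x (T f x)) =ᵐ[μ.restrict Q]
        κ • fun x => powOp W (1 / p) x (∫ y in R, f y ∂μ) := by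
      filter_upwards [ae_restrict_mem hQ] with x hx
      rw [h f hfR x hx, map_smul, Pi.smul_apply]
    rw [eLpNorm'_congr_ae h3, eLpNorm'_const_smul _ hp, Real.enorm_eq_ofReal_abs]
  calc X = ENNReal.ofReal |κ|⁻¹ * (ENNReal.ofReal |κ| * X) := by
        rw [← mul_assoc, ← ENNReal.ofReal_mul (by positivity), inv_mul_cancel₀ hκ'.ne',
          ENNReal.ofReal_one, one_mul]
    _ ≤ ENNReal.ofReal |κ|⁻¹ * (C * normLpW μ p W f) := by gcongr
    _ = ENNReal.ofReal (|κ|⁻¹ * C) * normLpW μ p W f := by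
        rw [← mul_assoc, ENNReal.ofReal_mul (by positivity), ENNReal.ofReal_coe_nnreal]
    _ ≤ _ := by
        gcongr
        rwa [inv_mul_le_iff₀ hκ']

theorem IsBalanced.integralBound_of_parents (hμ : IsBalanced D μ) (hp : 0 < p) {C : ℝ≥0} {N : ℕ}
    (hC : ∀ s t : ℕ, s + t ≤ N →
      ∀ T : (ℝ → EuclideanSpace ℝ (Fin d)) → (ℝ → EuclideanSpace ℝ (Fin d)),
        IsHaarShift D μ s t T → BoundedOnLpW μ p W T C) {Q R : Idx} {a b : ℕ} (hab : a + b ≤ N)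
    (h : D.parent^[a + 1] Q = D.parent^[b + 1] R) {M : ℝ}
    (hM : C * (μ.real (D.interval Q) * μ.real (D.interval R)) ≤
      √(mQ D μ (D.parent Q)) * √(mQ D μ (D.parent R)) * M) :
    IntegralBound μ p W (D.interval Q) (D.interval R) M := by
  set L := D.parent^[a + 1] Q with hL
  have hK : D.parent Q ∈ D.desc a L := D.mem_desc_iff.2 (by rw [hL, Function.iterate_succ_apply])
  have hJ : D.parent R ∈ D.desc b L := D.mem_desc_iff.2 (by rw [h, Function.iterate_succ_apply])
  -- The input Haar function sits at `R̂`, `b` generations below `L`, and the output one at `Q̂`,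
  -- `a` generations below: complexity `(b, a)`.
  have hT := hC b a (by omega) _ (hμ.isHaarShift_sum {L} (fun _ => D.parent R)
    (fun _ => D.parent Q) (by simpa using hJ) (by simpa using hK))
  obtain ⟨ε, hε, hQ⟩ := exists_haar_parent_eq D μ Q
  obtain ⟨δ, hδ, hR⟩ := exists_haar_parent_eq D μ R
  have hQ0 := hμ.real_pos Q
  have hR0 := hμ.real_pos R
  have hm1 := Real.sqrt_pos.2 (hμ.mQ_pos (D.parent Q))
  have hm2 := Real.sqrt_pos.2 (hμ.mQ_pos (D.parent R))
  have hκ : |(ε * (√(mQ D μ (D.parent Q)) / μ.real (D.interval Q))) *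
      (δ * (√(mQ D μ (D.parent R)) / μ.real (D.interval R)))| =
      √(mQ D μ (D.parent Q)) * √(mQ D μ (D.parent R)) /
        (μ.real (D.interval Q) * μ.real (D.interval R)) := by
    rw [abs_mul, abs_mul, abs_mul, hε, hδ, abs_of_pos (by positivity), abs_of_pos (by positivity)]
    field_simp
  refine integralBound_of_shift hT hp (D.measurableSet_interval Q)
    (κ := (ε * (√(mQ D μ (D.parent Q)) / μ.real (D.interval Q))) *
      (δ * (√(mQ D μ (D.parent R)) / μ.real (D.interval R)))) ?_ ?_ ?_
  · rw [← abs_pos, hκ]; positivity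
  · rw [hκ, div_mul_eq_mul_div, le_div_iff₀ (by positivity)]; exact hM
  · intro f hf x hx
    rw [Finset.sum_singleton, hQ x hx, setIntegral_haar_smul _ hR hf, ← mul_smul]
    rw [h]; exact D.interval_subset_iterate_parent R _

theorem IsBalanced.integralBound_self (hμ : IsBalanced D μ) (hp : 0 < p) {C : ℝ≥0}
    (hC : ∀ T : (ℝ → EuclideanSpace ℝ (Fin d)) → (ℝ → EuclideanSpace ℝ (Fin d)),
        IsHaarShift D μ 0 0 T → BoundedOnLpW μ p W T C) (Q : Idx) :
    IntegralBound μ p W (D.interval Q) (D.interval Q) (2 * C * μ.real (D.interval Q)) := by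
  classical
  obtain ⟨n, hn⟩ := hμ.exists_two_mul_le Q
  have hT := hC _ (hμ.isHaarShift_sum ((Finset.range n).image fun k => D.parent^[k + 1] Q) id id
    (by simp [DyadicGrid.desc]) (by simp [DyadicGrid.desc]))
  have hinj : Function.Injective fun k => D.parent^[k + 1] Q := fun k l hkl => by
    have h1 := congrArg Prod.fst hkl
    simp only [D.iterate_parent_fst] at h1
    push_cast at h1
    omega
  set w : ℕ → ℝ := fun k => 1 / μ.real (D.interval (D.parent^[k] Q)) with hw
  have hQ0 := hμ.real_pos Q
  have hn0 := hμ.real_pos (D.parent^[n] Q)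
  have hκ : 1 / (2 * μ.real (D.interval Q)) ≤ w 0 - w n := by
    have h1 : w n ≤ 1 / (2 * μ.real (D.interval Q)) :=
      one_div_le_one_div_of_le (by positivity) hn
    have h2 : w 0 = 2 * (1 / (2 * μ.real (D.interval Q))) := by
      simp only [hw, Function.iterate_zero, id]; field_simp
    rw [h2]; linarith
  have hκ0 : 0 < w 0 - w n := lt_of_lt_of_le (by positivity) hκ
  refine integralBound_of_shift hT hp (D.measurableSet_interval Q) (κ := w 0 - w n) hκ0.ne' ?_ ?_
  · rw [abs_of_pos hκ0]
    calc (C : ℝ) = 1 / (2 * μ.real (D.interval Q)) * (2 * C * μ.real (D.interval Q)) := by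
          field_simp
      _ ≤ _ := by gcongr
  · intro f hf x hx
    rw [Finset.sum_image hinj.injOn, ← Finset.sum_range_sub' w n, Finset.sum_smul]
    refine Finset.sum_congr rfl fun k _ => ?_
    obtain ⟨ε, hε, hh⟩ := exists_haar_parent_eq D μ (D.parent^[k] Q)
    have hsub := D.interval_subset_iterate_parent Q k
    -- The variables `x` and `y` lie in the same child of the ancestor, so the signs agree and all
    -- terms of the sum are positive.
    have hε2 : ε * ε = 1 := by rw [← abs_mul_abs_self, hε, one_mul]
    simp only [id, hw]
    rw [setIntegral_haar_smul (D.interval_subset_iterate_parent Q (k + 1))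
      (fun y hy => by rw [Function.iterate_succ_apply']; exact hh y (hsub hy)) hf, ← mul_smul,
      Function.iterate_succ_apply', hh x (hsub hx), ← hμ.mQ_parent_div]
    congr 1
    rw [mul_mul_mul_comm, hε2, one_mul, div_mul_div_comm,
      Real.mul_self_sqrt (hμ.mQ_pos _).le, sq]

end Shift

/-! ### From integration bounds to the `A_p^N` characteristic -/

section Characteristic

variable {D : DyadicGrid} {μ : Measure ℝ} {d : ℕ} {p : ℝ} {W : ℝ → Matrix (Fin d) (Fin d) ℝ}

theorem IntegralBound.lintegral_le {Q R : Idx} {M : ℝ} (hμ : IsBalanced D μ) (hp : 1 < p)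
    (hW : IsMatrixWeight μ W) (h : IntegralBound μ p W (D.interval Q) (D.interval R) M) :
    ∫⁻ x in D.interval Q, (∫⁻ y in D.interval R,
      ‖powOp W (1 / p) x * powOp W (-(1 / p)) y‖ₑ ^ (p / (p - 1)) ∂μ) ^ (p / (p / (p - 1))) ∂μ ≤
      (d * ENNReal.ofReal M) ^ p := by
  have hp0 : 0 < p := by linarith
  have hne : NeZero (μ.restrict (D.interval Q)) :=
    ⟨by simpa [Measure.restrict_eq_zero] using (hμ.pos Q).ne'⟩
  have hfin : IsFiniteMeasure (μ.restrict (D.interval R)) :=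
    ⟨by simpa using hμ.lt_top R⟩
  have hRm := D.measurableSet_interval R
  have h0 := mixed_norm_le (A := powOp W (1 / p)) (A' := powOp W (-(1 / p)))
    (C := powOp W (1 / p)) (B := powOp W (-(1 / p))) (μ := μ.restrict (D.interval Q))
    (ν := μ.restrict (D.interval R)) hp
    (memLp_powOp hW hp0 fun i j =>
      ((hW.locallyIntegrable i j).integrableOn_isCompact isCompact_Icc).mono_set Ico_subset_Icc_self)
    (ae_restrict_of_ae (by simpa using powOp_mul_powOp_neg hW (-(1 / p))))
    (aestronglyMeasurable_powOp hW _).restrict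
    (ae_restrict_of_ae (powOp_mul_powOp_neg hW (1 / p))) (fun y => inner_powOp W _ y)
    (ENNReal.ofReal M) ?_
  · simpa using h0
  · rintro f hf ⟨K, hK⟩ hlt
    -- Extension by zero; boundedness of `f` and `μ(R) < ∞` put it in `L²`, where shifts are
    -- defined.
    set g := (D.interval R).indicator f with hg
    have hgm : AEStronglyMeasurable g μ := (aestronglyMeasurable_indicator_iff hRm).2 hf
    have hg2 : MemLp g 2 μ := by
      refine (memLp_indicator_const 2 hRm K (Or.inr (hμ.lt_top R).ne)).mono' hgm
        (Eventually.of_forall fun y => ?_)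
      by_cases hy : y ∈ D.interval R
      · rw [hg, indicator_of_mem hy, indicator_of_mem hy]; exact hK y
      · rw [hg, indicator_of_notMem hy, indicator_of_notMem hy, norm_zero]
    have hnorm : normLpW μ p W g =
        eLpNorm' (fun y => powOp W (1 / p) y (f y)) p (μ.restrict (D.interval R)) := by
      rw [normLpW_eq, eLpNorm'_eq_lintegral_enorm, eLpNorm'_eq_lintegral_enorm,
        ← lintegral_indicator hRm]
      congr 2
      funext y
      by_cases hy : y ∈ D.interval R
      · rw [hg, indicator_of_mem hy, indicator_of_mem hy]
      · rw [hg, indicator_of_notMem hy, indicator_of_notMem hy, map_zero, enorm_zero,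
          ENNReal.zero_rpow_of_pos hp0]
    have h1 := h g hg2 (fun y hy => indicator_of_notMem hy f) (by rw [hnorm]; exact hlt)
    rw [hnorm, hg, setIntegral_indicator hRm, inter_self] at h1
    exact h1

/-- The bound for integration over `R` that corresponds to the constant `c_p^b(Q, R)`. -/
def sizeQR (D : DyadicGrid) (μ : Measure ℝ) (Q R : Idx) : ℝ :=
  if Q = R then μ.real (D.interval Q)
  else μ.real (D.interval Q) * μ.real (D.interval R) / √(mQ D μ Q * mQ D μ R)

theorem IsBalanced.sizeQR_pos (hμ : IsBalanced D μ) (Q R : Idx) : 0 < sizeQR D μ Q R := by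
  have h1 := hμ.real_pos Q
  have h2 := hμ.real_pos R
  have h3 := hμ.mQ_pos Q
  have h4 := hμ.mQ_pos R
  rw [sizeQR]
  split_ifs <;> positivity

/-- The scaling behind `c_p^b`: the right side is exactly what the two averages divide by, since `p
/ p' = p - 1`. -/
theorem IsBalanced.cpb_mul_sizeQR_rpow (hμ : IsBalanced D μ) (p : ℝ) (Q R : Idx) :
    cpb D μ p Q R * sizeQR D μ Q R ^ p =
      μ.real (D.interval R) ^ (p - 1) * μ.real (D.interval Q) := by
  have h1 := hμ.real_pos Q
  have h2 := hμ.real_pos R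
  have h3 := hμ.mQ_pos Q
  have h4 := hμ.mQ_pos R
  rw [sizeQR, cpb]
  split_ifs with h
  · subst h
    rw [one_mul, ← Real.rpow_add_one h1.ne', sub_add_cancel]
  · rw [Real.div_rpow (by positivity) (by positivity), Real.mul_rpow h1.le h2.le,
      Real.sqrt_eq_rpow, ← Real.rpow_mul (by positivity), Real.mul_rpow h3.le h4.le,
      Real.rpow_sub_one h1.ne', Real.rpow_sub_one h2.ne', one_div_mul_eq_div]
    field_simp

theorem IntegralBound.apN_term_le {Q R : Idx} {K : ℝ} (hK : 0 ≤ K) (hμ : IsBalanced D μ)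
    (hp : 1 < p) (hW : IsMatrixWeight μ W)
    (h : IntegralBound μ p W (D.interval Q) (D.interval R) (K * sizeQR D μ Q R)) :
    ENNReal.ofReal (cpb D μ p Q R) * ⨍⁻ x in D.interval Q, (⨍⁻ y in D.interval R,
      ‖Matrix.toEuclideanCLM (n := Fin d) (𝕜 := ℝ)
        (matPow (W x) (1 / p) * matPow (W y) (-(1 / p)))‖ₑ ^ (p / (p - 1)) ∂μ) ^
          (p / (p / (p - 1))) ∂μ ≤ ENNReal.ofReal ((d * K) ^ p) := by
  have hp0 : 0 < p := by linarith
  have hp1 : 0 < p - 1 := by linarith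
  have hpp : p / (p / (p - 1)) = p - 1 := by field_simp
  have h0 := h.lintegral_le hμ hp hW
  have hQ := hμ.real_pos Q
  have hR := hμ.real_pos R
  have hg := hμ.sizeQR_pos Q R
  have hc := hμ.cpb_mul_sizeQR_rpow p Q R
  simp only [setLAverage_eq, map_mul, hpp] at h0 ⊢
  simp only [ENNReal.div_rpow_of_nonneg _ _ hp1.le]
  simp only [div_eq_mul_inv]
  rw [lintegral_mul_const', ← hμ.ofReal_real Q, ← hμ.ofReal_real R,
    ENNReal.ofReal_rpow_of_pos hR, ← ENNReal.ofReal_inv_of_pos hQ,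
    ← ENNReal.ofReal_inv_of_pos (by positivity)]
  · calc _ ≤ ENNReal.ofReal (cpb D μ p Q R) * ((d * ENNReal.ofReal (K * sizeQR D μ Q R)) ^ p *
          ENNReal.ofReal (μ.real (D.interval R) ^ (p - 1))⁻¹ *
          ENNReal.ofReal (μ.real (D.interval Q))⁻¹) := by
          gcongr
          exact h0
      _ = ENNReal.ofReal (cpb D μ p Q R * ((d * (K * sizeQR D μ Q R)) ^ p *
          (μ.real (D.interval R) ^ (p - 1))⁻¹ * (μ.real (D.interval Q))⁻¹)) := by
          have hcpb : 0 ≤ cpb D μ p Q R := by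
            have h3 := hμ.mQ_pos Q
            have h4 := hμ.mQ_pos R
            rw [cpb]; split_ifs <;> positivity
          rw [ENNReal.ofReal_mul hcpb, ENNReal.ofReal_mul
              (p := (d * (K * sizeQR D μ Q R)) ^ p * (μ.real (D.interval R) ^ (p - 1))⁻¹)
              (by positivity),
            ENNReal.ofReal_mul (p := (d * (K * sizeQR D μ Q R)) ^ p) (by positivity),
            ← ENNReal.ofReal_rpow_of_nonneg (by positivity) hp0.le,
            ENNReal.ofReal_mul (Nat.cast_nonneg d), ENNReal.ofReal_natCast]
      _ = _ := by
          congr 1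
          rw [← mul_assoc (d : ℝ), Real.mul_rpow (by positivity) hg.le]
          calc _ = (d * K) ^ p * (cpb D μ p Q R * sizeQR D μ Q R ^ p) *
                (μ.real (D.interval R) ^ (p - 1))⁻¹ * (μ.real (D.interval Q))⁻¹ := by ring
            _ = _ := by rw [hc]; field_simp
  · rw [← hμ.ofReal_real R, ENNReal.ofReal_rpow_of_pos hR]
    exact ENNReal.inv_ne_top.2 (by simpa using by positivity)

theorem IsBalanced.integralBound_of_dist_le (hμ : IsBalanced D μ) (hp : 0 < p) {C : ℝ≥0} {N : ℕ}
    (hC : ∀ s t : ℕ, s + t ≤ N →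
      ∀ T : (ℝ → EuclideanSpace ℝ (Fin d)) → (ℝ → EuclideanSpace ℝ (Fin d)),
        IsHaarShift D μ s t T → BoundedOnLpW μ p W T C) {B : ℝ} (hB1 : 1 ≤ B)
    (hB : ∀ (n : ℕ) (Q : Idx), mQ D μ Q ≤ B ^ n * mQ D μ (D.parent^[n] Q) ∧
      mQ D μ (D.parent^[n] Q) ≤ B ^ n * mQ D μ Q) {Q R : Idx}
    (hQR : D.dist Q R ≤ ((N + 2 : ℕ) : ℕ∞)) :
    IntegralBound μ p W (D.interval Q) (D.interval R)
      (2 * C * B ^ (N + 2) * sizeQR D μ Q R) := by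
  have hself := hμ.integralBound_self hp (hC 0 0 (Nat.zero_le N))
  have hC0 : (0 : ℝ) ≤ C := C.2
  have hB0 : 0 < B := by linarith
  have hBn : ∀ n ≤ N + 2, B ^ n ≤ B ^ (N + 2) := fun n hn => pow_le_pow_right₀ hB1 hn
  have hm := hμ.mQ_pos
  have hr := hμ.real_pos
  rcases eq_or_ne Q R with rfl | hne
  · refine (hself Q).mono hp (D.measurableSet_interval Q) subset_rfl subset_rfl ?_
    rw [sizeQR, if_pos rfl]
    have h1 : 1 ≤ B ^ (N + 2) := one_le_pow₀ hB1
    have h2 := hr Q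
    refine mul_le_mul_of_nonneg_right ?_ h2.le
    exact le_mul_of_one_le_right (by positivity) h1
  have hs : sizeQR D μ Q R =
      μ.real (D.interval Q) * μ.real (D.interval R) / √(mQ D μ Q * mQ D μ R) := if_neg hne
  have hsq : 0 < √(mQ D μ Q * mQ D μ R) := Real.sqrt_pos.2 (mul_pos (hm Q) (hm R))
  -- the nested case
  have hnest : ∀ Q R : Idx, ∀ b ≤ N + 2, Q = D.parent^[b] R →
      √(mQ D μ Q * mQ D μ R) ≤ B ^ (N + 2) * μ.real (D.interval R) := by
    intro Q R b hb hQ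
    -- By balance `m(Q)` is at most a constant times `m(R)`, hence so is the geometric mean, and
    -- `m(R) ≤ μ(R)`. Thus the bound for the larger interval alone is strong enough.
    have h1 : mQ D μ Q ≤ B ^ (N + 2) * mQ D μ R := by
      rw [hQ]
      exact (hB b R).2.trans (mul_le_mul_of_nonneg_right (hBn b hb) (hm R).le)
    calc √(mQ D μ Q * mQ D μ R) ≤ √((B ^ (N + 2) * mQ D μ R) ^ 2) := by
          apply Real.sqrt_le_sqrt
          rw [sq]
          have h2 : mQ D μ R ≤ B ^ (N + 2) * mQ D μ R :=
            le_mul_of_one_le_left (hm R).le (one_le_pow₀ hB1)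
          exact mul_le_mul h1 h2 (hm R).le ((hm Q).le.trans h1)
      _ = B ^ (N + 2) * mQ D μ R := Real.sqrt_sq (mul_nonneg (by positivity) (hm R).le)
      _ ≤ _ := by gcongr; exact hμ.mQ_le R
  obtain ⟨a, b, hab, hL⟩ := D.exists_of_dist_le hQR
  rcases a with _ | a
  · have hQ : Q = D.parent^[b] R := hL
    have hsub : D.interval R ⊆ D.interval Q := hQ ▸ D.interval_subset_iterate_parent R b
    refine (hself Q).mono hp (D.measurableSet_interval Q) subset_rfl hsub ?_
    rw [hs, mul_div_assoc', le_div_iff₀ hsq]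
    have h2 := hr Q
    calc _ ≤ 2 * C * μ.real (D.interval Q) * (B ^ (N + 2) * μ.real (D.interval R)) := by
          gcongr
          exact hnest Q R b (by omega) hQ
      _ = _ := by ring
  rcases b with _ | b
  · have hR : R = D.parent^[a + 1] Q := hL.symm
    have hsub : D.interval Q ⊆ D.interval R := hR ▸ D.interval_subset_iterate_parent Q _
    refine (hself R).mono hp (D.measurableSet_interval R) hsub subset_rfl ?_
    rw [hs, mul_div_assoc', le_div_iff₀ hsq]
    have h2 := hr R
    calc _ ≤ 2 * C * μ.real (D.interval R) * (B ^ (N + 2) * μ.real (D.interval Q)) := by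
          gcongr
          rw [mul_comm]
          exact hnest R Q (a + 1) (by omega) hR
      _ = _ := by ring
  -- Both intervals lie strictly below the common ancestor. Passing to parents saves one generation
  -- on each side, which is why distance `N + 2` is reached with complexity `N`.
  · refine hμ.integralBound_of_parents hp hC (by omega) hL ?_
    have h1 := (hB 1 Q).1
    have h2 := (hB 1 R).1
    simp only [pow_one, Function.iterate_one] at h1 h2
    have h3 : √(mQ D μ Q * mQ D μ R) ≤
        B * (√(mQ D μ (D.parent Q)) * √(mQ D μ (D.parent R))) := by
      rw [← Real.sqrt_mul (hm _).le]
      apply Real.sqrt_le_iff.2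
      refine ⟨by positivity, ?_⟩
      rw [mul_pow, Real.sq_sqrt (mul_pos (hm _) (hm _)).le]
      calc _ ≤ (B * mQ D μ (D.parent Q)) * (B * mQ D μ (D.parent R)) :=
            mul_le_mul h1 h2 (hm R).le ((hm Q).le.trans h1)
        _ = _ := by ring
    have h4 : B ≤ 2 * B ^ (N + 2) := by
      have := hBn 1 (by omega)
      rw [pow_one] at this
      nlinarith
    have hQ0 := hr Q
    have hR0 := hr R
    rw [hs, mul_div_assoc', mul_div_assoc', le_div_iff₀ hsq]
    calc _ ≤ C * (μ.real (D.interval Q) * μ.real (D.interval R)) *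
          (2 * B ^ (N + 2) * (√(mQ D μ (D.parent Q)) * √(mQ D μ (D.parent R)))) := by
          gcongr
          exact h3.trans (by gcongr)
      _ = _ := by ring

end Characteristic

end

end HaarShift

open HaarShift in
theorem mainTheorem6 (D : DyadicGrid) (μ : Measure ℝ) (hμ : IsBalanced D μ)
    (d N : ℕ) (p : ℝ) (hp : 1 < p)
    (W : ℝ → Matrix (Fin d) (Fin d) ℝ) (hW : IsMatrixWeight μ W)
    (C : ℝ≥0)
    (hC : ∀ s t : ℕ, s + t ≤ N →
      ∀ T : (ℝ → EuclideanSpace ℝ (Fin d)) → (ℝ → EuclideanSpace ℝ (Fin d)),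
        IsHaarShift D μ s t T → BoundedOnLpW μ p W T C) :
    ApN D μ p N W < ∞ := by
  obtain ⟨B, hB1, hB⟩ := hμ.exists_iterate
  refine lt_of_le_of_lt (iSup_le fun Q => iSup_le fun R => iSup_le fun hQR => ?_)
    (ENNReal.ofReal_lt_top (r := (d * (2 * C * B ^ (N + 2))) ^ p))
  exact (hμ.integralBound_of_dist_le (by linarith) hC hB1 hB hQR).apN_term_le
    (by have := C.2; positivity) hμ hp hW
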